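/- Let $M\subset S^{N-1}(r_0)=\{x\in\mathbb R^N:\|x\|=r_0\}$, $r_0>0$, be a compact connected (embedded, smooth) $n$-dimensional isoparametric submanifold of $\mathbb R^N$, $n\ge 1$; that is, the normal bundle $\nu M$ is flat and the principal curvatures along any (local) parallel normal field are constant. Fix $x_0\in M$. Let ${\bf n}_1,\dots,{\bf n}_g\in\nu_{x_0}M$ be the curvature normals of $M$ at $x_0$, i.e. the distinct normal vectors for which the common eigenspace $E_i=\{u\in T_{x_0}M: A_vu=\langle v,{\bf n}_i\rangle u\ \ \forall v\in\nu_{x_0}M\}$ of the shape operators is nonzero, and let $m_i=\dim E_i$. (1) Let $\xi:[0,T)\to\nu_{x_0}M$ satisfy $$\dot\xi(t)=\sum_{i=1}^g\frac{m_i{\bf n}_i}{1-\langle\xi(t),{\bf n}_i\rangle},\qquad \xi(0)=0,\qquad \langle\xi(t),{\bf n}_i\rangle<1\ \text{ for all } i \text{ and } t,$$ and put $x(t)=x_0+\xi(t)$. Then $\langle x(t),{\bf n}_i\rangle\neq0$ for all $i$ and $$x'(t)=-\sum_{i=1}^g\frac{m_i{\bf n}_i}{\langle x(t),{\bf n}_i\rangle},\qquad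 x(0)=x_0 .$$ For each $t$ the vector $\xi(t)$ extends to a parallel normal field $\hat\xi_t$ on all of $M$. For any such extension, $y\mapsto y+\hat\xi_t(y)$ is an immersion of $M$, whose image is the parallel submanifold $M(t)=M_{\xi(t)}$. If $H(t)$ denotes its mean curvature vector (the trace of the second fundamental form) at the point $x(t)$, then (a) $\langle x(t),H(t)\rangle=-n$, (b) $\|x(t)\|^2=\|x(0)\|^2-2nt$. (2) The mean curvature flow in $\mathbb R^N$ with initial data $M$ exists only for finite time, with maximal interval $[0,T)$ where $0<T\le r_0^2/(2n)$. Precisely: there are $T\in(0,r_0^2/(2n)]$ and a solution $\xi$ on $[0,T)$ of the problem in (1) such that every solution on an interval $[0,T')$ has $T'\le T$ and coincides with $\xi$ there; the maps $f(t,y)=y+\hat\xi_t(y)$ form a smooth mean curvature flow $f:[0,T)\times M\to\mathbb R^N$ (each $f(t,\cdot)$ is an immersion with $\partial_tf$ equal to its mean curvature vector, and $f(0,\cdot)$ is the inclusion), and this flow has no extension to a smooth mean curvature flow on a larger interval $[0,T')$; moreover any smooth mean curvature flow $[0,T')\times M\to\mathbb R^N$ whose initial map is the inclusion of $M$ has $T'\le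 r_0^2/(2n)$. -/

import Mathlib

open scoped ContDiff RealInnerProductSpace

noncomputable section

namespace MCFIso

variable {N : ℕ}

/-- `M` is a smooth embedded submanifold of dimension `n` of `ℝ^N`: around each of its points there
is a smooth slice chart of the ambient space, straightening `M` to an `n`-dimensional linear
subspace. -/
def IsSubmanifold (n : ℕ) (M : Set (EuclideanSpace ℝ (Fin N))) : Prop :=
  ∀ p ∈ M, ∃ (Φ : OpenPartialHomeomorph (EuclideanSpace ℝ (Fin N)) (EuclideanSpace ℝ (Fin N)))
    (W : Submodule ℝ (EuclideanSpace ℝ (Fin N))),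
    p ∈ Φ.source ∧ ContDiffOn ℝ ∞ Φ Φ.source ∧ ContDiffOn ℝ ∞ Φ.symm Φ.target ∧
    Module.finrank ℝ W = n ∧ ∀ y ∈ Φ.source, (y ∈ M ↔ Φ y ∈ W)

/-- The tangent space `T_x M` as a linear subspace of `ℝ^N` (for a submanifold the tangent cone is
already a subspace). -/
def tangentSpace (M : Set (EuclideanSpace ℝ (Fin N))) (x : EuclideanSpace ℝ (Fin N)) :
    Submodule ℝ (EuclideanSpace ℝ (Fin N)) :=
  Submodule.span ℝ (tangentConeAt ℝ M x)

/-- The normal space `ν_x M`. -/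
def normalSpace (M : Set (EuclideanSpace ℝ (Fin N))) (x : EuclideanSpace ℝ (Fin N)) :
    Submodule ℝ (EuclideanSpace ℝ (Fin N)) :=
  (tangentSpace M x)ᗮ

/-- The differential at `x` of a map `f` defined on the submanifold `M`. Only its values on
`T_x M` are meaningful (and these do not depend on any choice). -/
def diff (M : Set (EuclideanSpace ℝ (Fin N)))
    (f : EuclideanSpace ℝ (Fin N) → EuclideanSpace ℝ (Fin N)) (x : EuclideanSpace ℝ (Fin N)) :
    EuclideanSpace ℝ (Fin N) →L[ℝ] EuclideanSpace ℝ (Fin N) :=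
  fderivWithin ℝ f M x

/-- `η` is a parallel normal field along the relatively open subset `S` of `M`: it is smooth and
normal to `M`, and its covariant derivative for the normal connection (the normal part of its
derivative) vanishes. -/
structure IsParallelNormalField (M S : Set (EuclideanSpace ℝ (Fin N)))
    (η : EuclideanSpace ℝ (Fin N) → EuclideanSpace ℝ (Fin N)) : Prop where
  smooth : ContDiffOn ℝ ∞ η S
  normal : ∀ x ∈ S, η x ∈ normalSpace M x
  parallel : ∀ x ∈ S, ∀ v ∈ tangentSpace M x, diff M η x v ∈ tangentSpace M x

/-- The shape operator `A_v : T_x M → T_x M`, `A_v u = -(D_u V)ᵀ`, where `V` is a normal field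
extending the normal vector `v` (the operator does not depend on the extension; we take
`V y =` the component of `v` normal to `M` at `y`). -/
def shapeOperator (M : Set (EuclideanSpace ℝ (Fin N))) (x v : EuclideanSpace ℝ (Fin N)) :
    Module.End ℝ (tangentSpace M x) :=
  -((tangentSpace M x).orthogonalProjectionOnto ∘L
      (diff M (fun y => (normalSpace M y).starProjection v) x) ∘L
      (tangentSpace M x).subtypeL).toLinearMap

/-- `M` is an `n`-dimensional isoparametric submanifold of `ℝ^N`: a submanifold with flat normal
bundle (each normal vector extends to a parallel normal field on a neighbourhood) such that the
principal curvatures (with multiplicities) along any parallel normal field, on any connected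
relatively open subset, are constant. -/
structure IsIsoparametric (n : ℕ) (M : Set (EuclideanSpace ℝ (Fin N))) : Prop where
  submanifold : IsSubmanifold n M
  flat : ∀ p ∈ M, ∀ v ∈ normalSpace M p, ∃ (U : Set (EuclideanSpace ℝ (Fin N)))
    (η : EuclideanSpace ℝ (Fin N) → EuclideanSpace ℝ (Fin N)),
    IsOpen U ∧ p ∈ U ∧ IsParallelNormalField M (M ∩ U) η ∧ η p = v
  constant : ∀ (U : Set (EuclideanSpace ℝ (Fin N)))
    (η : EuclideanSpace ℝ (Fin N) → EuclideanSpace ℝ (Fin N)),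
    IsOpen U → IsPreconnected (M ∩ U) → IsParallelNormalField M (M ∩ U) η →
    ∀ x ∈ M ∩ U, ∀ y ∈ M ∩ U, ∀ c : ℝ,
      Module.finrank ℝ ((shapeOperator M x (η x)).eigenspace c) =
        Module.finrank ℝ ((shapeOperator M y (η y)).eigenspace c)

/-- For a normal vector `ν` at `x`: the subspace of the `u ∈ T_x M` with `A_v u = ⟨v, ν⟩ u` for
all normal vectors `v` at `x`. -/
def curvatureSpace (M : Set (EuclideanSpace ℝ (Fin N))) (x ν : EuclideanSpace ℝ (Fin N)) :
    Submodule ℝ (tangentSpace M x) :=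
  ⨅ v : normalSpace M x,
    (shapeOperator M x (v : EuclideanSpace ℝ (Fin N))).eigenspace
      ⟪(v : EuclideanSpace ℝ (Fin N)), ν⟫

theorem finite_curvatureNormals (M : Set (EuclideanSpace ℝ (Fin N)))
    (x : EuclideanSpace ℝ (Fin N)) :
    {ν : EuclideanSpace ℝ (Fin N) | ν ∈ normalSpace M x ∧ curvatureSpace M x ν ≠ ⊥}.Finite := by
  by_contra hinf
  obtain ⟨S, hS, hcard⟩ := Set.Infinite.exists_subset_card_eq hinf
    (Module.finrank ℝ (tangentSpace M x) + 1)
  let w : {p : S × S // p.1 ≠ p.2} → normalSpace M x := fun p =>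
    ⟨p.1.1, (hS p.1.1.2).1⟩ - ⟨p.1.2, (hS p.1.2.2).1⟩
  have hw : ∀ p, w p ≠ 0 := by
    intro p h
    apply p.2
    have h1 := sub_eq_zero.1 h
    exact Subtype.ext (congrArg (fun z : normalSpace M x => (z : EuclideanSpace ℝ (Fin N))) h1)
  obtain ⟨φ, hφ⟩ := Module.exists_dual_forall_apply_ne_zero (K := ℝ) w hw
  let v : normalSpace M x :=
    (InnerProductSpace.toDual ℝ (normalSpace M x)).symm (LinearMap.toContinuousLinearMap φ)
  have hv : ∀ z : normalSpace M x,
      ⟪(v : EuclideanSpace ℝ (Fin N)), (z : EuclideanSpace ℝ (Fin N))⟫ = φ z := by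
    intro z
    rw [← Submodule.coe_inner, InnerProductSpace.toDual_symm_apply]
    rfl
  have hne : ∀ ν : S, ∃ u ∈ curvatureSpace M x ν, u ≠ 0 := fun ν =>
    Submodule.exists_mem_ne_zero_of_ne_bot (hS ν.2).2
  choose u hu hu0 using hne
  have hli : LinearIndependent ℝ u := by
    refine Module.End.eigenvectors_linearIndependent' (shapeOperator M x v)
      (fun ν : S => ⟪(v : EuclideanSpace ℝ (Fin N)), (ν : EuclideanSpace ℝ (Fin N))⟫) ?_ u ?_
    · intro a b hab
      by_contra hne
      apply hφ ⟨(a, b), hne⟩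
      simp only [w, map_sub]
      rw [← hv, ← hv]
      exact sub_eq_zero.2 hab
    · intro ν
      exact ⟨(Submodule.mem_iInf _).1 (hu ν) v, hu0 ν⟩
  have := hli.fintype_card_le_finrank
  rw [Fintype.card_coe, hcard] at this
  omega

/-- The curvature normals `n_1, …, n_g` of `M` at `x`: the normal vectors whose common eigenspace
is nonzero. -/
def curvatureNormals (M : Set (EuclideanSpace ℝ (Fin N))) (x : EuclideanSpace ℝ (Fin N)) :
    Finset (EuclideanSpace ℝ (Fin N)) :=
  (finite_curvatureNormals M x).toFinset

/-- The multiplicity of a curvature normal. -/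
def multiplicity (M : Set (EuclideanSpace ℝ (Fin N))) (x ν : EuclideanSpace ℝ (Fin N)) : ℕ :=
  Module.finrank ℝ (curvatureSpace M x ν)

/-- `f` restricts to an immersion of `M`. -/
def IsImmersionOn (M : Set (EuclideanSpace ℝ (Fin N)))
    (f : EuclideanSpace ℝ (Fin N) → EuclideanSpace ℝ (Fin N)) : Prop :=
  ContDiffOn ℝ ∞ f M ∧ ∀ x ∈ M, ∀ v ∈ tangentSpace M x, diff M f x v = 0 → v = 0

/-- The second fundamental form of the immersion `f : M → ℝ^N` at `p`, pulled back to `T_p M`: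
the component of `D_u (df(W))` normal to `df(T_p M)`, where `W` is the tangent field on `M`
extending `w` given by orthogonal projection (any extension gives the same value). -/
def secondFundamentalForm (M : Set (EuclideanSpace ℝ (Fin N)))
    (f : EuclideanSpace ℝ (Fin N) → EuclideanSpace ℝ (Fin N))
    (p u w : EuclideanSpace ℝ (Fin N)) : EuclideanSpace ℝ (Fin N) :=
  ((tangentSpace M p).map (diff M f p).toLinearMap)ᗮ.starProjection
    (diff M (fun y => diff M f y ((tangentSpace M y).starProjection w)) p u)

/-- The induced metric (first fundamental form) of the immersion `f` at `p` in an orthonormal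
basis of `T_p M ⊆ ℝ^N`. -/
def inducedMetric (M : Set (EuclideanSpace ℝ (Fin N)))
    (f : EuclideanSpace ℝ (Fin N) → EuclideanSpace ℝ (Fin N)) (p : EuclideanSpace ℝ (Fin N)) :
    Matrix (Fin (Module.finrank ℝ (tangentSpace M p)))
      (Fin (Module.finrank ℝ (tangentSpace M p))) ℝ :=
  Matrix.of fun i j =>
    ⟪diff M f p (stdOrthonormalBasis ℝ (tangentSpace M p) i),
      diff M f p (stdOrthonormalBasis ℝ (tangentSpace M p) j)⟫

/-- The mean curvature vector at `f p` of the immersed submanifold `f : M → ℝ^N`: the trace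
`∑ gⁱʲ II(b_i, b_j)` of the second fundamental form with respect to the induced metric. -/
def meanCurvatureVector (M : Set (EuclideanSpace ℝ (Fin N)))
    (f : EuclideanSpace ℝ (Fin N) → EuclideanSpace ℝ (Fin N)) (p : EuclideanSpace ℝ (Fin N)) :
    EuclideanSpace ℝ (Fin N) :=
  ∑ i, ∑ j, (inducedMetric M f p)⁻¹ i j •
    secondFundamentalForm M f p (stdOrthonormalBasis ℝ (tangentSpace M p) i)
      (stdOrthonormalBasis ℝ (tangentSpace M p) j)

/-- `f : [0, T) × M → ℝ^N` is a smooth mean curvature flow in `ℝ^N` with initial data `M`. -/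
structure IsMeanCurvatureFlow (M : Set (EuclideanSpace ℝ (Fin N))) (T : ℝ)
    (f : ℝ → EuclideanSpace ℝ (Fin N) → EuclideanSpace ℝ (Fin N)) : Prop where
  smooth : ContDiffOn ℝ ∞ (fun q : ℝ × EuclideanSpace ℝ (Fin N) => f q.1 q.2) (Set.Ico 0 T ×ˢ M)
  initial : ∀ x ∈ M, f 0 x = x
  immersion : ∀ t ∈ Set.Ico 0 T, IsImmersionOn M (f t)
  flow : ∀ t ∈ Set.Ico 0 T, ∀ x ∈ M,
    HasDerivWithinAt (fun s => f s x) (meanCurvatureVector M (f t) x) (Set.Ico 0 T) t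

/-- `ξ : [0, T) → ν_{x₀} M` solves `ξ' = ∑ᵢ mᵢ nᵢ / (1 - ⟨ξ, nᵢ⟩)`, `ξ(0) = 0`, with
`x₀ + ξ` staying in the chamber `⟨ξ, nᵢ⟩ < 1`. -/
structure IsFlowSolution (M : Set (EuclideanSpace ℝ (Fin N))) (x₀ : EuclideanSpace ℝ (Fin N))
    (T : ℝ) (ξ : ℝ → EuclideanSpace ℝ (Fin N)) : Prop where
  initial : ξ 0 = 0
  normal : ∀ t ∈ Set.Ico 0 T, ξ t ∈ normalSpace M x₀
  chamber : ∀ t ∈ Set.Ico 0 T, ∀ ν ∈ curvatureNormals M x₀, ⟪ξ t, ν⟫ < 1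
  flow : ∀ t ∈ Set.Ico 0 T, HasDerivWithinAt ξ
    (∑ ν ∈ curvatureNormals M x₀, ((multiplicity M x₀ ν : ℝ) / (1 - ⟪ξ t, ν⟫)) • ν)
    (Set.Ico 0 T) t

end MCFIso

end

/-!
For a general submanifold, mean curvature flow is a partial differential equation for a map. For an
isoparametric submanifold `M` it reduces to one ordinary differential equation in a normal space:
for a parallel normal field `η` with `⟪η, nᵢ⟫ < 1`, the differential of `y ↦ y + η y` is
`1 - A_η`, with eigenvalues `1 - ⟪η, nᵢ⟫`, and its mean curvature vector is
`∑ mᵢ nᵢ / (1 - ⟪η, nᵢ⟫)` (`meanCurvatureVector_add`). This is the right-hand side `flowField` of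
the flow equation.

The normal bundle is only assumed to be locally flat, so a global parallel normal field through
`ξ t` has to be constructed. Local parallel transport carries curvature normals to curvature
normals with the same multiplicities (`IsParallelTransport.multiplicity_eq`, which is where the
constancy of the principal curvatures enters) and therefore conjugates the flow equations at
different points of `M`. As `M` is connected, the flow equation is solvable on the same time
interval at every point (`IsFlowSolution.exists_forall`), and uniqueness of solutions makes
`y ↦ Ξ y t`, where `Ξ y` solves the flow equation at `y`, invariant under local parallel transport:
it is a parallel normal field on all of `M` (`isParallelNormalField_flowSolution`), and the maps
`y ↦ y + Ξ y t` form a mean curvature flow (`isMeanCurvatureFlow_flowSolution`).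

As `M` lies in a sphere about the origin, the position vector is a parallel normal field with shape
operator `-1`, so `⟪x, nᵢ⟫ = -1` (`inner_curvatureNormal`). This gives `⟪x(t), H(t)⟫ = -n`, hence
`‖x(t)‖² = r₀² - 2nt`, hence the bound on the existence time of solutions of the flow equation. For
an arbitrary mean curvature flow the same bound follows from the maximum principle: at a point
farthest from the origin `⟪f, H⟫ ≤ -n`, so that the flow stays within the shrinking ball
(`IsMeanCurvatureFlow.norm_sq_le`).

Finally, suppose that the flow given by the maximal solution `ξ` on `[0, T)` had an extension beyond
`T`. Then `ξ` would converge at `T`. If the limit satisfies `⟪ξ, nᵢ⟫ < 1` for all `i`, the solution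
itself can be continued; if not, `⟪ξ, nᵢ⟫ = 1` for some `i`, and the extension is not immersive at
time `T`, as its differential kills the principal directions of `nᵢ`
(`IsMeanCurvatureFlow.le_of_maximal`).

Calculus on `M` is done with smooth local retractions `π` of the ambient space onto `M`: the
tangent space at `x` is the range of `Dπ x`, and `D²π x` encodes the second fundamental form.
-/

namespace MCFIso

open Filter Topology

variable {N : ℕ}

local notation "𝔼" => EuclideanSpace ℝ (Fin N)

/-! ### Local retractions -/

/-- Two derivatives within `M` agree on the tangent space. -/
theorem fderiv_unique_on_tangentSpace {F : Type*} [NormedAddCommGroup F] [NormedSpace ℝ F]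
    {M : Set 𝔼} {x : 𝔼} {f : 𝔼 → F} {f₁ f₂ : 𝔼 →L[ℝ] F}
    (h₁ : HasFDerivWithinAt f f₁ M x) (h₂ : HasFDerivWithinAt f f₂ M x) {v : 𝔼}
    (hv : v ∈ tangentSpace M x) : f₁ v = f₂ v := by
  have : tangentSpace M x ≤ LinearMap.eqLocus f₁.toLinearMap f₂.toLinearMap :=
    Submodule.span_le.2 fun w hw => h₁.unique_on h₂ hw
  exact this hv

/-- `π` is a smooth retraction of the open set `O` of the ambient space onto `M ∩ O`. It turns maps
defined on `M` into maps defined on an open set, and so reduces calculus on `M` to ordinary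
calculus. -/
structure IsRetraction (M O : Set 𝔼) (π : 𝔼 → 𝔼) : Prop where
  isOpen : IsOpen O
  smooth : ContDiffOn ℝ ∞ π O
  mapsTo : ∀ y ∈ O, π y ∈ M ∩ O
  fix : ∀ y ∈ M ∩ O, π y = y

theorem IsRetraction.restrict {M O U : Set 𝔼} {π : 𝔼 → 𝔼} (R : IsRetraction M O π)
    (hU : IsOpen U) : IsRetraction M (U ∩ (O ∩ π ⁻¹' U)) π where
  isOpen := hU.inter (R.smooth.continuousOn.isOpen_inter_preimage R.isOpen hU)
  smooth := R.smooth.mono fun _ hy => hy.2.1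
  mapsTo := by
    rintro y ⟨-, hyO, hyU⟩
    have h := R.mapsTo y hyO
    exact ⟨h.1, hyU, h.2, by rw [Set.mem_preimage, R.fix _ h]; exact hyU⟩
  fix := fun y hy => R.fix y ⟨hy.1, hy.2.2.1⟩

theorem IsRetraction.mem_restrict {M O U : Set 𝔼} {π : 𝔼 → 𝔼} (R : IsRetraction M O π) {x : 𝔼}
    (hx : x ∈ M ∩ O) (hU : x ∈ U) : x ∈ M ∩ (U ∩ (O ∩ π ⁻¹' U)) :=
  ⟨hx.1, hU, hx.2, by rw [Set.mem_preimage, R.fix x hx]; exact hU⟩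

/-- In a slice chart the retraction is the orthogonal projection onto the slice. -/
theorem IsSubmanifold.exists_isRetraction {n : ℕ} {M : Set 𝔼} (hM : IsSubmanifold n M) {p : 𝔼}
    (hp : p ∈ M) : ∃ (O : Set 𝔼) (π : 𝔼 → 𝔼), IsRetraction M O π ∧ p ∈ M ∩ O ∧
      Module.finrank ℝ (LinearMap.range (fderiv ℝ π p).toLinearMap) = n := by
  obtain ⟨Φ, W, hps, hΦ, hΦs, hW, hMW⟩ := hM p hp
  have hΦp : Φ p ∈ W := (hMW p hps).1 hp
  have hPp : W.starProjection (Φ p) = Φ p := Submodule.starProjection_eq_self_iff.2 hΦp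
  have hopen : IsOpen (Φ.source ∩ Φ ⁻¹' (W.starProjection ⁻¹' Φ.target)) :=
    Φ.continuousOn.isOpen_inter_preimage Φ.open_source
      (Φ.open_target.preimage W.starProjection.continuous)
  refine ⟨Φ.source ∩ Φ ⁻¹' (W.starProjection ⁻¹' Φ.target),
    fun y => Φ.symm (W.starProjection (Φ y)), ⟨hopen, ?_, ?_, ?_⟩, ⟨hp, hps, ?_⟩, ?_⟩
  · refine hΦs.comp (W.starProjection.contDiff.comp_contDiffOn (hΦ.mono fun _ hy => hy.1)) ?_
    exact fun y hy => hy.2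
  · rintro y ⟨hy, hyt⟩
    have h1 : Φ (Φ.symm (W.starProjection (Φ y))) = W.starProjection (Φ y) := Φ.right_inv hyt
    have h2 : Φ.symm (W.starProjection (Φ y)) ∈ Φ.source := Φ.map_target hyt
    have h3 : W.starProjection (Φ y) ∈ W := Submodule.starProjection_apply_mem _ _
    refine ⟨(hMW _ h2).2 (by rw [h1]; exact h3), h2, ?_⟩
    simp only [Set.mem_preimage, h1]
    rw [Submodule.starProjection_eq_self_iff.2 h3]
    exact hyt
  · rintro y ⟨hyM, hy, -⟩
    simp only [Submodule.starProjection_eq_self_iff.2 ((hMW y hy).1 hyM)]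
    exact Φ.left_inv hy
  · simp only [Set.mem_preimage, hPp]
    exact Φ.map_source hps
  · have hd1 : HasFDerivAt Φ (fderiv ℝ Φ p) p :=
      ((hΦ.contDiffAt (Φ.open_source.mem_nhds hps)).differentiableAt (by simp)).hasFDerivAt
    have hd2 : HasFDerivAt Φ.symm (fderiv ℝ Φ.symm (Φ p)) (Φ p) :=
      ((hΦs.contDiffAt (Φ.open_target.mem_nhds (Φ.map_source hps))).differentiableAt
        (by simp)).hasFDerivAt
    set A := fderiv ℝ Φ.symm (Φ p)
    set B := fderiv ℝ Φ p
    have hAB : A ∘L B = ContinuousLinearMap.id ℝ 𝔼 := by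
      have h1 := hd2.comp p hd1
      refine h1.unique ((hasFDerivAt_id p).congr_of_eventuallyEq ?_)
      filter_upwards [Φ.open_source.mem_nhds hps] with y hy using Φ.left_inv hy
    have hBA : B ∘L A = ContinuousLinearMap.id ℝ 𝔼 := by
      have hd1' : HasFDerivAt Φ B (Φ.symm (Φ p)) := by rwa [Φ.left_inv hps]
      have h1 := hd1'.comp (Φ p) hd2
      refine h1.unique ((hasFDerivAt_id _).congr_of_eventuallyEq ?_)
      filter_upwards [Φ.open_target.mem_nhds (Φ.map_source hps)] with y hy using Φ.right_inv hy
    have hd2' : HasFDerivAt Φ.symm A (W.starProjection (Φ p)) := by rwa [hPp]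
    have hder : fderiv ℝ (fun y => Φ.symm (W.starProjection (Φ y))) p
        = A ∘L W.starProjection ∘L B :=
      (hd2'.comp p (W.starProjection.hasFDerivAt.comp p hd1)).fderiv
    have hrange : LinearMap.range (A ∘L W.starProjection ∘L B).toLinearMap
        = W.map A.toLinearMap := by
      ext z
      constructor
      · rintro ⟨y, rfl⟩
        exact ⟨W.starProjection (B y), Submodule.starProjection_apply_mem _ _, rfl⟩
      · rintro ⟨w, hw, rfl⟩
        refine ⟨A w, ?_⟩
        have h2 : B (A w) = w := DFunLike.congr_fun hBA w
        simp [h2, Submodule.starProjection_eq_self_iff.2 hw]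
    have hinj : Function.Injective A.toLinearMap := fun a b hab => by
      have h2 : ∀ w, B (A w) = w := fun w => DFunLike.congr_fun hBA w
      rw [← h2 a, ← h2 b]
      exact congrArg B hab
    rw [hder, hrange, ← hW]
    exact (LinearEquiv.finrank_eq (Submodule.equivMapOfInjective A.toLinearMap hinj W)).symm

/-- Every neighbourhood of a point of a submanifold contains an open neighbourhood whose trace on
the submanifold is connected. -/
theorem IsSubmanifold.exists_isOpen_isPreconnected {n : ℕ} {M : Set 𝔼} (hM : IsSubmanifold n M)
    {p : 𝔼} (hp : p ∈ M) {O : Set 𝔼} (hO : IsOpen O) (hpO : p ∈ O) :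
    ∃ U, IsOpen U ∧ p ∈ U ∧ U ⊆ O ∧ IsPreconnected (M ∩ U) := by
  obtain ⟨Φ, W, hps, hΦ, hΦs, hW, hMW⟩ := hM p hp
  have h1 : IsOpen (Φ.target ∩ Φ.symm ⁻¹' O) :=
    Φ.symm.continuousOn.isOpen_inter_preimage Φ.open_target hO
  have h2 : Φ p ∈ Φ.target ∩ Φ.symm ⁻¹' O :=
    ⟨Φ.map_source hps, by rw [Set.mem_preimage, Φ.left_inv hps]; exact hpO⟩
  obtain ⟨r, hr, hball⟩ := Metric.isOpen_iff.1 h1 _ h2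
  refine ⟨Φ.source ∩ Φ ⁻¹' Metric.ball (Φ p) r,
    Φ.continuousOn.isOpen_inter_preimage Φ.open_source Metric.isOpen_ball,
    ⟨hps, Set.mem_preimage.2 (Metric.mem_ball_self hr)⟩, ?_, ?_⟩
  · rintro y ⟨hy, hyb⟩
    have hyO := (hball (Set.mem_preimage.1 hyb)).2
    rwa [Set.mem_preimage, Φ.left_inv hy] at hyO
  · have : M ∩ (Φ.source ∩ Φ ⁻¹' Metric.ball (Φ p) r) =
        Φ.symm '' ((W : Set 𝔼) ∩ Metric.ball (Φ p) r) := by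
      ext y
      constructor
      · rintro ⟨hyM, hy, hyb⟩
        exact ⟨Φ y, ⟨(hMW y hy).1 hyM, hyb⟩, Φ.left_inv hy⟩
      · rintro ⟨z, ⟨hzW, hzb⟩, rfl⟩
        have hzt := (hball hzb).1
        have hs := Φ.map_target hzt
        refine ⟨(hMW _ hs).2 ?_, hs, ?_⟩
        · rw [Φ.right_inv hzt]; exact hzW
        · rw [Set.mem_preimage, Φ.right_inv hzt]; exact hzb
    rw [this]
    have hconv : Convex ℝ ((W : Set 𝔼) ∩ Metric.ball (Φ p) r) :=
      W.convex.inter (convex_ball _ _)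
    exact hconv.isPreconnected.image _ (Φ.continuousOn_symm.mono fun z hz => (hball hz.2).1)

namespace IsRetraction

variable {M O : Set (EuclideanSpace ℝ (Fin N))}
  {π : EuclideanSpace ℝ (Fin N) → EuclideanSpace ℝ (Fin N)} {x : EuclideanSpace ℝ (Fin N)}

theorem mem_nhds (R : IsRetraction M O π) (hx : x ∈ M ∩ O) : O ∈ nhds x :=
  R.isOpen.mem_nhds hx.2

theorem hasFDerivAt (R : IsRetraction M O π) (hx : x ∈ O) : HasFDerivAt π (fderiv ℝ π x) x :=
  ((R.smooth.contDiffAt (R.isOpen.mem_nhds hx)).differentiableAt (by simp)).hasFDerivAt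

theorem eventually_mem (R : IsRetraction M O π) (hx : x ∈ M ∩ O) :
    ∀ᶠ y in nhdsWithin x M, y ∈ M ∩ O :=
  Filter.inter_mem self_mem_nhdsWithin (mem_nhdsWithin_of_mem_nhds (R.mem_nhds hx))

/-- The differential of a retraction is a projection onto the tangent space. -/
theorem mem_tangentSpace_iff (R : IsRetraction M O π) (hx : x ∈ M ∩ O) {v : 𝔼} :
    v ∈ tangentSpace M x ↔ fderiv ℝ π x v = v := by
  constructor
  · intro hv
    have h1 : HasFDerivWithinAt π (fderiv ℝ π x) M x := (R.hasFDerivAt hx.2).hasFDerivWithinAt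
    have h2 : HasFDerivWithinAt π (ContinuousLinearMap.id ℝ 𝔼) M x := by
      refine (hasFDerivWithinAt_id x M).congr_of_eventuallyEq ?_ (R.fix x hx)
      filter_upwards [R.eventually_mem hx] with y hy using R.fix y hy
    exact fderiv_unique_on_tangentSpace h1 h2 hv
  · intro hv
    rw [← hv]
    have h1 : HasFDerivWithinAt π (fderiv ℝ π x) O x := (R.hasFDerivAt hx.2).hasFDerivWithinAt
    have h2 : v ∈ tangentConeAt ℝ O x := by
      rw [tangentConeAt_of_mem_nhds (R.mem_nhds hx)]; trivial
    have h3 := h1.mapsTo_tangent_cone h2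
    rw [R.fix x hx] at h3
    refine Submodule.subset_span (tangentConeAt_mono ?_ h3)
    rintro _ ⟨y, hy, rfl⟩
    exact (R.mapsTo y hy).1

theorem fderiv_apply_mem (R : IsRetraction M O π) (hx : x ∈ M ∩ O) (v : 𝔼) :
    fderiv ℝ π x v ∈ tangentSpace M x := by
  have h1 : HasFDerivAt π (fderiv ℝ π x) (π x) := by rw [R.fix x hx]; exact R.hasFDerivAt hx.2
  have h2 := h1.comp x (R.hasFDerivAt hx.2)
  have h3 : HasFDerivAt (π ∘ π) (fderiv ℝ π x) x := by
    refine (R.hasFDerivAt hx.2).congr_of_eventuallyEq ?_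
    filter_upwards [R.mem_nhds hx] with y hy using R.fix _ (R.mapsTo y hy)
  exact (R.mem_tangentSpace_iff hx).2 (DFunLike.congr_fun (h2.unique h3) v)

theorem range_fderiv (R : IsRetraction M O π) (hx : x ∈ M ∩ O) :
    LinearMap.range (fderiv ℝ π x).toLinearMap = tangentSpace M x := by
  ext v
  constructor
  · rintro ⟨w, rfl⟩
    exact R.fderiv_apply_mem hx w
  · intro hv
    exact ⟨v, (R.mem_tangentSpace_iff hx).1 hv⟩

end IsRetraction

theorem IsSubmanifold.finrank_tangentSpace {n : ℕ} {M : Set 𝔼} (hM : IsSubmanifold n M) {p : 𝔼}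
    (hp : p ∈ M) : Module.finrank ℝ (tangentSpace M p) = n := by
  obtain ⟨O, π, R, hpO, h⟩ := hM.exists_isRetraction hp
  rw [← R.range_fderiv hpO, h]

/-! ### Second fundamental form and shape operators -/

theorem two_le_infty : (2 : ℕ∞ω) ≤ ∞ :=
  ENat.LEInfty.out

theorem mem_normalSpace_iff {M : Set 𝔼} {x v : 𝔼} :
    v ∈ normalSpace M x ↔ ∀ u ∈ tangentSpace M x, ⟪u, v⟫ = 0 :=
  Submodule.mem_orthogonal _ _

theorem inner_tangent_normal {M : Set 𝔼} {x u v : 𝔼} (hu : u ∈ tangentSpace M x)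
    (hv : v ∈ normalSpace M x) : ⟪u, v⟫ = 0 :=
  mem_normalSpace_iff.1 hv u hu

theorem inner_normal_tangent {M : Set 𝔼} {x u v : 𝔼} (hu : u ∈ tangentSpace M x)
    (hv : v ∈ normalSpace M x) : ⟪v, u⟫ = 0 := by
  rw [real_inner_comm]; exact inner_tangent_normal hu hv

theorem normalSpace_starProjection {M : Set 𝔼} (x v : 𝔼) :
    (normalSpace M x).starProjection v = v - (tangentSpace M x).starProjection v := by
  rw [normalSpace, Submodule.starProjection_orthogonal']
  rfl

theorem fderivWithin_eq_zero_of_eventually {M : Set 𝔼} {x : 𝔼} (hx : x ∈ M)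
    {F : Type*} [NormedAddCommGroup F] [NormedSpace ℝ F]
    {k : 𝔼 → F} {k' : 𝔼 →L[ℝ] F} (hk : HasFDerivWithinAt k k' M x)
    (h0 : ∀ᶠ y in 𝓝[M] x, k y = 0) {u : 𝔼} (hu : u ∈ tangentSpace M x) : k' u = 0 := by
  have h2 : HasFDerivWithinAt k (0 : 𝔼 →L[ℝ] F) M x :=
    (hasFDerivWithinAt_const (0 : F) x M).congr_of_eventuallyEq h0 (h0.self_of_nhdsWithin hx)
  exact fderiv_unique_on_tangentSpace hk h2 hu

/-- For a projection `Q`, not necessarily orthogonal, `1 + Q - Q†` is invertible, as `Q - Q†` is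
skew. -/
theorem isUnit_one_add_sub_adjoint (Q : 𝔼 →L[ℝ] 𝔼) :
    IsUnit (1 + Q - ContinuousLinearMap.adjoint Q) := by
  have hinj : Function.Injective (1 + Q - ContinuousLinearMap.adjoint Q : 𝔼 →L[ℝ] 𝔼) := by
    rw [injective_iff_map_eq_zero]
    intro v hv
    have h : ⟪(1 + Q - ContinuousLinearMap.adjoint Q) v, v⟫ = ⟪v, v⟫ := by
      have h1 : (1 + Q - ContinuousLinearMap.adjoint Q) v
          = v + Q v - ContinuousLinearMap.adjoint Q v := rfl
      rw [h1, inner_sub_left, inner_add_left, ContinuousLinearMap.adjoint_inner_left,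
        real_inner_comm (Q v) v]
      ring
    rw [hv, inner_zero_left] at h
    exact inner_self_eq_zero.1 h.symm
  rw [ContinuousLinearMap.isUnit_iff_bijective]
  exact ⟨hinj, LinearMap.injective_iff_surjective.1 hinj⟩

namespace IsRetraction

variable {M O : Set (EuclideanSpace ℝ (Fin N))}
  {π : EuclideanSpace ℝ (Fin N) → EuclideanSpace ℝ (Fin N)} {x : EuclideanSpace ℝ (Fin N)}

theorem contDiffOn_fderiv (R : IsRetraction M O π) : ContDiffOn ℝ ∞ (fderiv ℝ π) O :=
  R.smooth.fderiv_of_isOpen R.isOpen (by simp)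

theorem hasFDerivAt_fderiv (R : IsRetraction M O π) (hx : x ∈ O) :
    HasFDerivAt (fderiv ℝ π) (fderiv ℝ (fderiv ℝ π) x) x :=
  ((R.contDiffOn_fderiv.contDiffAt (R.isOpen.mem_nhds hx)).differentiableAt (by simp)).hasFDerivAt

theorem fderiv_fderiv_comm (R : IsRetraction M O π) (hx : x ∈ O) (u w : 𝔼) :
    fderiv ℝ (fderiv ℝ π) x u w = fderiv ℝ (fderiv ℝ π) x w u :=
  (R.smooth.contDiffAt (R.isOpen.mem_nhds hx)).isSymmSndFDerivAt
    (by rw [minSmoothness_of_isRCLikeNormedField]; exact two_le_infty) u w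

/-- The orthogonal projection onto the tangent spaces depends smoothly on the base point. By the
Kerzman–Stein formula it is `Q (1 + Q - Q†)⁻¹`, where `Q` is the differential of the
retraction. -/
theorem exists_contDiffOn_starProjection (R : IsRetraction M O π) :
    ∃ P : 𝔼 → 𝔼 →L[ℝ] 𝔼, ContDiffOn ℝ ∞ P O ∧
      ∀ y ∈ M ∩ O, P y = (tangentSpace M y).starProjection := by
  let adj : (𝔼 →L[ℝ] 𝔼) →ₗ[ℝ] (𝔼 →L[ℝ] 𝔼) :=
    { toFun := fun Q => ContinuousLinearMap.adjoint Q
      map_add' := fun a b => map_add _ a b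
      map_smul' := fun c a => by simp }
  have hadj : ContDiff ℝ ∞ (fun Q : 𝔼 →L[ℝ] 𝔼 => ContinuousLinearMap.adjoint Q) :=
    (LinearMap.toContinuousLinearMap adj).contDiff
  refine ⟨fun y => fderiv ℝ π y *
    Ring.inverse (1 + fderiv ℝ π y - ContinuousLinearMap.adjoint (fderiv ℝ π y)), ?_, ?_⟩
  · intro y hy
    have h1 : ContDiffAt ℝ ∞ (fderiv ℝ π) y := R.contDiffOn_fderiv.contDiffAt (R.isOpen.mem_nhds hy)
    obtain ⟨a, ha⟩ := isUnit_one_add_sub_adjoint (fderiv ℝ π y)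
    have h2 : ContDiffAt ℝ ∞ (Ring.inverse : (𝔼 →L[ℝ] 𝔼) → (𝔼 →L[ℝ] 𝔼))
        (1 + fderiv ℝ π y - ContinuousLinearMap.adjoint (fderiv ℝ π y)) := by
      rw [← ha]; exact contDiffAt_ringInverse ℝ a
    have h3 : ContDiffAt ℝ ∞
        (fun y => 1 + fderiv ℝ π y - ContinuousLinearMap.adjoint (fderiv ℝ π y)) y :=
      (contDiffAt_const.add h1).sub (hadj.contDiffAt.comp y h1)
    have h4 := h2.comp y h3
    exact (h1.clm_comp h4).contDiffWithinAt
  · intro y hy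
    set Q := fderiv ℝ π y with hQ
    have hu := isUnit_one_add_sub_adjoint Q
    set P := (tangentSpace M y).starProjection with hP
    have hPQ : P * Q = Q := by
      ext1 v
      exact Submodule.starProjection_eq_self_iff.2 (R.fderiv_apply_mem hy v)
    have hQP : Q * P = P := by
      ext1 v
      exact (R.mem_tangentSpace_iff hy).1 (Submodule.starProjection_apply_mem _ v)
    have hPa : ContinuousLinearMap.adjoint P = P :=
      (isSelfAdjoint_starProjection (tangentSpace M y))
    have hPQa : P * ContinuousLinearMap.adjoint Q = P := by
      have h := congrArg ContinuousLinearMap.adjoint hQP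
      rw [ContinuousLinearMap.mul_def, ContinuousLinearMap.adjoint_comp, hPa] at h
      exact h
    have key : P * (1 + Q - ContinuousLinearMap.adjoint Q) = Q := by
      rw [mul_sub, mul_add, hPQ, hPQa, mul_one]; abel
    calc Q * Ring.inverse (1 + Q - ContinuousLinearMap.adjoint Q)
        = P * (1 + Q - ContinuousLinearMap.adjoint Q) *
          Ring.inverse (1 + Q - ContinuousLinearMap.adjoint Q) := by rw [key]
      _ = P := by rw [mul_assoc, Ring.mul_inverse_cancel _ hu, mul_one]

/-- The tangential part of the derivative of a normal field `Z` depends on the value of `Z` at the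
base point only. The second derivative of the retraction plays the role of the second
fundamental form. -/
theorem inner_deriv_normalField (R : IsRetraction M O π) (hx : x ∈ M ∩ O) {Z : 𝔼 → 𝔼}
    {Z' : 𝔼 →L[ℝ] 𝔼} (hZ : HasFDerivWithinAt Z Z' M x)
    (hn : ∀ᶠ y in 𝓝[M] x, Z y ∈ normalSpace M y) {u w : 𝔼}
    (hu : u ∈ tangentSpace M x) (hw : w ∈ tangentSpace M x) :
    ⟪Z' u, w⟫ = -⟪Z x, fderiv ℝ (fderiv ℝ π) x u w⟫ := by
  have h1 : HasFDerivWithinAt (fun y => fderiv ℝ π y w)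
      ((fderiv ℝ (fderiv ℝ π) x).flip w) M x := by
    have := ((R.hasFDerivAt_fderiv hx.2).clm_apply
      (hasFDerivAt_const w x)).hasFDerivWithinAt (s := M)
    refine this.congr_fderiv ?_
    ext1 v; simp
  have h2 := hZ.inner ℝ h1
  have h3 := fderivWithin_eq_zero_of_eventually hx.1 h2 (by
    filter_upwards [hn, R.eventually_mem hx] with y hy hyO
    exact inner_normal_tangent (R.fderiv_apply_mem hyO w) hy) hu
  simp only [fderivInnerCLM_apply, ContinuousLinearMap.comp_apply, ContinuousLinearMap.prod_apply,
    ContinuousLinearMap.flip_apply, (R.mem_tangentSpace_iff hx).1 hw] at h3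
  linarith

/-- The normal part of the derivative of a tangential field depends on the value of the field at
the base point only. -/
theorem inner_deriv_tangentField (R : IsRetraction M O π) (hx : x ∈ M ∩ O) {X : 𝔼 → 𝔼}
    {X' : 𝔼 →L[ℝ] 𝔼} (hX : HasFDerivWithinAt X X' M x)
    (hn : ∀ᶠ y in 𝓝[M] x, X y ∈ tangentSpace M y) {u v : 𝔼}
    (hu : u ∈ tangentSpace M x) (hv : v ∈ normalSpace M x) :
    ⟪v, X' u⟫ = ⟪v, fderiv ℝ (fderiv ℝ π) x u (X x)⟫ := by
  have h1 := ((R.hasFDerivAt_fderiv hx.2).hasFDerivWithinAt (s := M)).clm_apply hX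
  have h3 := fderivWithin_eq_zero_of_eventually hx.1 (h1.sub hX) (by
    filter_upwards [hn, R.eventually_mem hx] with y hy hyO
    exact sub_eq_zero.2 ((R.mem_tangentSpace_iff hyO).1 hy)) hu
  simp only [sub_apply, add_apply,
    ContinuousLinearMap.comp_apply, ContinuousLinearMap.flip_apply, sub_eq_zero] at h3
  rw [← h3, inner_add_right, inner_normal_tangent (R.fderiv_apply_mem hx _) hv, zero_add]

theorem hasFDerivWithinAt_normalProjection (R : IsRetraction M O π) (hx : x ∈ M ∩ O) (v : 𝔼) :
    HasFDerivWithinAt (fun y => (normalSpace M y).starProjection v)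
      (diff M (fun y => (normalSpace M y).starProjection v) x) M x := by
  obtain ⟨P, hP, hPM⟩ := R.exists_contDiffOn_starProjection
  have h1 : DifferentiableAt ℝ (fun y => v - P y v) x :=
    (((hP.contDiffAt (R.mem_nhds hx)).differentiableAt (by simp)).clm_apply
      (differentiableAt_const v)).const_sub v
  refine (h1.differentiableWithinAt.congr_of_eventuallyEq_of_mem ?_ hx.1).hasFDerivWithinAt
  filter_upwards [R.eventually_mem hx] with y hy
  rw [normalSpace_starProjection, hPM y hy]

/-- The shape operator in terms of the second derivative of the retraction. -/
theorem inner_shapeOperator (R : IsRetraction M O π) (hx : x ∈ M ∩ O) {v : 𝔼}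
    (hv : v ∈ normalSpace M x) (u w : tangentSpace M x) :
    ⟪shapeOperator M x v u, w⟫ = ⟪v, fderiv ℝ (fderiv ℝ π) x u w⟫ := by
  have h := R.inner_deriv_normalField hx (R.hasFDerivWithinAt_normalProjection hx v)
    (Eventually.of_forall fun y => Submodule.starProjection_apply_mem _ v) u.2 w.2
  rw [Submodule.starProjection_eq_self_iff.2 hv] at h
  have h2 : shapeOperator M x v u = -((tangentSpace M x).orthogonalProjectionOnto
      (diff M (fun y => (normalSpace M y).starProjection v) x u)) := rfl
  rw [h2, inner_neg_left, real_inner_comm,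
    Submodule.inner_orthogonalProjectionOnto_eq_of_mem_left, real_inner_comm, h, neg_neg]

/-- The shape operators are symmetric because second derivatives are. -/
theorem shapeOperator_isSymmetric (R : IsRetraction M O π) (hx : x ∈ M ∩ O) {v : 𝔼}
    (hv : v ∈ normalSpace M x) : (shapeOperator M x v).IsSymmetric := fun u w => by
  rw [R.inner_shapeOperator hx hv, R.fderiv_fderiv_comm hx.2, ← R.inner_shapeOperator hx hv,
    real_inner_comm]

theorem contDiffOn_comp (R : IsRetraction M O π) {F : Type*} [NormedAddCommGroup F]
    [NormedSpace ℝ F] {f : 𝔼 → F} (hf : ContDiffOn ℝ ∞ f (M ∩ O)) :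
    ContDiffOn ℝ ∞ (fun y => f (π y)) O :=
  hf.comp R.smooth R.mapsTo

theorem hasFDerivAt_comp (R : IsRetraction M O π) {F : Type*} [NormedAddCommGroup F]
    [NormedSpace ℝ F] {f : 𝔼 → F} (hf : ContDiffOn ℝ ∞ f (M ∩ O)) (hx : x ∈ O) :
    HasFDerivAt (fun y => f (π y)) (fderiv ℝ (fun y => f (π y)) x) x :=
  (((R.contDiffOn_comp hf).contDiffAt (R.isOpen.mem_nhds hx)).differentiableAt
    (by simp)).hasFDerivAt

theorem hasFDerivWithinAt_fderiv_comp (R : IsRetraction M O π) {F : Type*} [NormedAddCommGroup F]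
    [NormedSpace ℝ F] {f : 𝔼 → F} (hf : ContDiffOn ℝ ∞ f (M ∩ O)) (hx : x ∈ M ∩ O) :
    HasFDerivWithinAt f (fderiv ℝ (fun y => f (π y)) x) M x := by
  refine (R.hasFDerivAt_comp hf hx.2).hasFDerivWithinAt.congr_of_eventuallyEq ?_
    (by simp only [R.fix x hx])
  filter_upwards [R.eventually_mem hx] with y hy
  rw [R.fix y hy]

theorem diff_eq (R : IsRetraction M O π) {f : 𝔼 → 𝔼} (hf : ContDiffOn ℝ ∞ f (M ∩ O))
    (hx : x ∈ M ∩ O) {u : 𝔼} (hu : u ∈ tangentSpace M x) :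
    diff M f x u = fderiv ℝ (fun y => f (π y)) x u := by
  have h := R.hasFDerivWithinAt_fderiv_comp hf hx
  exact fderiv_unique_on_tangentSpace h.differentiableWithinAt.hasFDerivWithinAt h hu

/-- `f ∘ π` extends `f` to be constant along the fibres of `π`, so its differential factors through
the differential of `π`. -/
theorem fderiv_comp_apply (R : IsRetraction M O π) {f : 𝔼 → 𝔼} (hf : ContDiffOn ℝ ∞ f (M ∩ O))
    (hx : x ∈ M ∩ O) (u : 𝔼) :
    fderiv ℝ (fun y => f (π y)) x u = diff M f x (fderiv ℝ π x u) := by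
  rw [R.diff_eq hf hx (R.fderiv_apply_mem hx u)]
  have h1 : HasFDerivAt (fun y => f (π y)) (fderiv ℝ (fun y => f (π y)) x) (π x) := by
    rw [R.fix x hx]; exact R.hasFDerivAt_comp hf hx.2
  have h2 := h1.comp x (R.hasFDerivAt hx.2)
  have h3 := (R.hasFDerivAt_comp hf hx.2).congr_of_eventuallyEq (f₁ := (fun y => f (π y)) ∘ π) (by
    filter_upwards [R.mem_nhds hx] with y hy
    simp only [Function.comp, R.fix _ (R.mapsTo y hy)])
  exact DFunLike.congr_fun (h3.unique h2) u

end IsRetraction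

theorem IsParallelNormalField.hasFDerivWithinAt {M U : Set 𝔼} {η : 𝔼 → 𝔼} (hU : IsOpen U)
    (h : IsParallelNormalField M (M ∩ U) η) {x : 𝔼} (hx : x ∈ M ∩ U) :
    HasFDerivWithinAt η (diff M η x) M x := by
  have h1 := ((h.smooth x hx).differentiableWithinAt (by simp))
  have h2 : DifferentiableWithinAt ℝ η M x :=
    (differentiableWithinAt_inter (hU.mem_nhds hx.2)).1 h1
  exact h2.hasFDerivWithinAt

theorem IsParallelNormalField.eventually_mem {M U : Set 𝔼} {η : 𝔼 → 𝔼} (hU : IsOpen U)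
    (h : IsParallelNormalField M (M ∩ U) η) {x : 𝔼} (hx : x ∈ M ∩ U) :
    ∀ᶠ y in 𝓝[M] x, η y ∈ normalSpace M y := by
  filter_upwards [self_mem_nhdsWithin, mem_nhdsWithin_of_mem_nhds (hU.mem_nhds hx.2)] with y h1 h2
  exact h.normal y ⟨h1, h2⟩

/-- Weingarten equation for a parallel normal field. -/
theorem IsParallelNormalField.diff_apply {n : ℕ} {M U : Set 𝔼} (hM : IsSubmanifold n M) {η : 𝔼 → 𝔼}
    (hU : IsOpen U) (h : IsParallelNormalField M (M ∩ U) η) {x : 𝔼} (hx : x ∈ M ∩ U)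
    (u : tangentSpace M x) : diff M η x u = -(shapeOperator M x (η x) u : 𝔼) := by
  obtain ⟨O, π, R, hxO, -⟩ := hM.exists_isRetraction hx.1
  have hd : diff M η x u ∈ tangentSpace M x := h.parallel x hx u u.2
  have key : (⟨diff M η x u, hd⟩ : tangentSpace M x) = -(shapeOperator M x (η x) u) := by
    refine ext_inner_right ℝ fun w => ?_
    rw [inner_neg_left, R.inner_shapeOperator hxO (h.normal x hx)]
    exact R.inner_deriv_normalField hxO (h.hasFDerivWithinAt hU hx) (h.eventually_mem hU hx) u.2 w.2
  exact congrArg Subtype.val key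

theorem IsParallelNormalField.mono {M S S' : Set 𝔼} {η : 𝔼 → 𝔼} (h : IsParallelNormalField M S η)
    (hS : S' ⊆ S) : IsParallelNormalField M S' η :=
  ⟨h.smooth.mono hS, fun x hx => h.normal x (hS hx), fun x hx => h.parallel x (hS hx)⟩

/-- The Ricci equation for a flat normal bundle: the shape operators of parallel normal fields
commute. -/
theorem IsParallelNormalField.commute {n : ℕ} {M U : Set 𝔼} (hM : IsSubmanifold n M) {η ζ : 𝔼 → 𝔼}
    (hU : IsOpen U) (hη : IsParallelNormalField M (M ∩ U) η)
    (hζ : IsParallelNormalField M (M ∩ U) ζ) {x : 𝔼} (hx : x ∈ M ∩ U) :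
    Commute (shapeOperator M x (η x)) (shapeOperator M x (ζ x)) := by
  obtain ⟨O₀, π, R₀, hxO₀, -⟩ := hM.exists_isRetraction hx.1
  have R := R₀.restrict hU
  have hxO := R₀.mem_restrict hxO₀ hx.2
  have hsub : M ∩ (U ∩ (O₀ ∩ π ⁻¹' U)) ⊆ M ∩ U := fun y hy => ⟨hy.1, hy.2.1⟩
  set O := U ∩ (O₀ ∩ π ⁻¹' U)
  have hηs := hη.smooth.mono hsub
  set F : 𝔼 → 𝔼 := fun y => η (π y) with hF
  have hFs : ContDiffOn ℝ ∞ F O := R.contDiffOn_comp hηs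
  have hFs' : ContDiffOn ℝ ∞ (fderiv ℝ F) O := hFs.fderiv_of_isOpen R.isOpen (by simp)
  have hFd : HasFDerivAt (fderiv ℝ F) (fderiv ℝ (fderiv ℝ F) x) x :=
    ((hFs'.contDiffAt (R.mem_nhds hxO)).differentiableAt (by simp)).hasFDerivAt
  have hsymm : ∀ u w, fderiv ℝ (fderiv ℝ F) x u w = fderiv ℝ (fderiv ℝ F) x w u :=
    (hFs.contDiffAt (R.mem_nhds hxO)).isSymmSndFDerivAt
    (by rw [minSmoothness_of_isRCLikeNormedField]; exact two_le_infty)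
  have hFT : ∀ y ∈ M ∩ O, ∀ v, fderiv ℝ F y v ∈ tangentSpace M y := fun y hy v => by
    rw [R.fderiv_comp_apply hηs hy]
    exact hη.parallel y (hsub hy) _ (R.fderiv_apply_mem hy v)
  -- differentiate `⟪dη(u), ζ⟫ = 0` in the direction `w`
  have key : ∀ u ∈ tangentSpace M x, ∀ w ∈ tangentSpace M x,
      ⟪diff M η x u, diff M ζ x w⟫ + ⟪fderiv ℝ (fderiv ℝ F) x w u, ζ x⟫ = 0 := by
    intro u hu w hw
    have h1 : HasFDerivWithinAt (fun y => fderiv ℝ F y u)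
        ((fderiv ℝ (fderiv ℝ F) x).flip u) M x := by
      have := (hFd.clm_apply (hasFDerivAt_const u x)).hasFDerivWithinAt (s := M)
      refine this.congr_fderiv ?_
      ext1 v; simp
    have h2 := h1.inner ℝ (hζ.hasFDerivWithinAt hU hx)
    have h3 := fderivWithin_eq_zero_of_eventually hx.1 h2 (by
      filter_upwards [hζ.eventually_mem hU hx, R.eventually_mem hxO] with y hy hyO
      exact inner_tangent_normal (hFT y hyO u) hy) hw
    simp only [fderivInnerCLM_apply, ContinuousLinearMap.comp_apply,
      ContinuousLinearMap.prod_apply, ContinuousLinearMap.flip_apply] at h3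
    rwa [R.diff_eq hηs hxO hu]
  have hsη := R.shapeOperator_isSymmetric hxO (hη.normal x hx)
  have hsζ := R.shapeOperator_isSymmetric hxO (hζ.normal x hx)
  refine LinearMap.ext fun u => ext_inner_right ℝ fun w => ?_
  change ⟪shapeOperator M x (η x) (shapeOperator M x (ζ x) u), w⟫ =
    ⟪shapeOperator M x (ζ x) (shapeOperator M x (η x) u), w⟫
  rw [hsη (shapeOperator M x (ζ x) u) w, hsζ (shapeOperator M x (η x) u) w]
  have e1 := key u u.2 w w.2
  have e2 := key w w.2 u u.2
  rw [hsymm] at e2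
  rw [hη.diff_apply hM hU hx u, hζ.diff_apply hM hU hx w, inner_neg_neg] at e1
  rw [hη.diff_apply hM hU hx w, hζ.diff_apply hM hU hx u, inner_neg_neg] at e2
  rw [Submodule.coe_inner, Submodule.coe_inner]
  rw [real_inner_comm] at e2
  linarith

/-! ### Principal frames and curvature normals -/

/-- A subspace cut out by the vanishing of the coordinates outside `J` has dimension `#J`. -/
theorem finrank_eq_card_of_mem_iff {ι V : Type*} [Fintype ι] [AddCommGroup V] [Module ℝ V]
    (b : Module.Basis ι ℝ V) (S : Submodule ℝ V) (J : Finset ι)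
    (h : ∀ u, u ∈ S ↔ ∀ i ∉ J, b.repr u i = 0) : Module.finrank ℝ S = J.card := by
  have hS : S = Submodule.span ℝ (Set.range fun j : J => b j) := by
    have : (Set.range fun j : J => b j) = b '' (J : Set ι) := by
      ext z; simp
    rw [this]
    ext u
    rw [h, Module.Basis.mem_span_image]
    constructor
    · intro hu i hi
      by_contra hiJ
      exact (Finsupp.mem_support_iff.1 hi) (hu i hiJ)
    · intro hu i hi
      by_contra hne
      exact hi (hu (Finsupp.mem_support_iff.2 hne))
  have hli : LinearIndependent ℝ fun j : J => b j :=
    b.linearIndependent.comp _ Subtype.val_injective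
  rw [hS, finrank_span_eq_card hli]
  simp

theorem IsSubmanifold.shapeOperator_isSymmetric {n : ℕ} {M : Set 𝔼} (hM : IsSubmanifold n M)
    {x : 𝔼} (hx : x ∈ M) {v : 𝔼} (hv : v ∈ normalSpace M x) :
    (shapeOperator M x v).IsSymmetric := by
  obtain ⟨O, π, R, hxO, -⟩ := hM.exists_isRetraction hx
  exact R.shapeOperator_isSymmetric hxO hv

theorem IsIsoparametric.commute_shapeOperator {n : ℕ} {M : Set 𝔼} (hM : IsIsoparametric n M)
    {x : 𝔼} (hx : x ∈ M) {v w : 𝔼} (hv : v ∈ normalSpace M x) (hw : w ∈ normalSpace M x) :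
    Commute (shapeOperator M x v) (shapeOperator M x w) := by
  obtain ⟨U, η, hU, hxU, hη, rfl⟩ := hM.flat x hx v hv
  obtain ⟨U', ζ, hU', hxU', hζ, rfl⟩ := hM.flat x hx w hw
  refine IsParallelNormalField.commute hM.submanifold (hU.inter hU')
    (hη.mono (Set.inter_subset_inter_right _ Set.inter_subset_left))
    (hζ.mono (Set.inter_subset_inter_right _ Set.inter_subset_right)) ⟨hx, hxU, hxU'⟩

/-- An orthonormal basis `b` of `T_x M` which diagonalizes all shape operators at once:
`A_v (b i) = ⟪v, ν i⟫ b i`. The `ν i` are the curvature normals, each repeated according to its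
multiplicity. -/
structure IsPrincipalFrame {n : ℕ} (M : Set 𝔼) (x : 𝔼)
    (b : OrthonormalBasis (Fin n) ℝ (tangentSpace M x)) (ν : Fin n → 𝔼) : Prop where
  normal : ∀ i, ν i ∈ normalSpace M x
  apply : ∀ v ∈ normalSpace M x, ∀ i, shapeOperator M x v (b i) = ⟪v, ν i⟫ • b i

theorem mem_curvatureNormals {M : Set 𝔼} {x w : 𝔼} :
    w ∈ curvatureNormals M x ↔ w ∈ normalSpace M x ∧ curvatureSpace M x w ≠ ⊥ := by
  simp [curvatureNormals]

theorem mem_curvatureSpace {M : Set 𝔼} {x w : 𝔼} {u : tangentSpace M x} :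
    u ∈ curvatureSpace M x w ↔
      ∀ v ∈ normalSpace M x, shapeOperator M x v u = ⟪v, w⟫ • u := by
  simp [curvatureSpace, Submodule.mem_iInf]

/-- The shape operators at a point are commuting symmetric operators, so they are simultaneously
diagonalizable; each joint eigenvalue is linear in the normal vector and is thus represented by a
curvature normal. -/
theorem IsIsoparametric.exists_isPrincipalFrame {n : ℕ} {M : Set 𝔼} (hM : IsIsoparametric n M)
    {x : 𝔼} (hx : x ∈ M) :
    ∃ (b : OrthonormalBasis (Fin n) ℝ (tangentSpace M x)) (ν : Fin n → 𝔼),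
      IsPrincipalFrame M x b ν := by
  classical
  obtain ⟨O, π, R, hxO, -⟩ := hM.submanifold.exists_isRetraction hx
  let A : normalSpace M x → Module.End ℝ (tangentSpace M x) := fun v => shapeOperator M x v
  have hA : ∀ v, (A v).IsSymmetric := fun v => R.shapeOperator_isSymmetric hxO v.2
  have hC : Pairwise (Function.onFun Commute A) := fun v w _ =>
    hM.commute_shapeOperator hx v.2 w.2
  let V : {w // w ∈ curvatureNormals M x} → Submodule ℝ (tangentSpace M x) :=
    fun w => curvatureSpace M x w
  have hOF : OrthogonalFamily ℝ (fun w => V w) fun w => (V w).subtypeₗᵢ := by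
    refine OrthogonalFamily.of_pairwise fun a c hac u hu w hw => ?_
    have hd : (a : 𝔼) - c ∈ normalSpace M x :=
      Submodule.sub_mem _ (mem_curvatureNormals.1 a.2).1 (mem_curvatureNormals.1 c.2).1
    have hne : ⟪(a : 𝔼) - c, (a : 𝔼)⟫ ≠ ⟪(a : 𝔼) - c, (c : 𝔼)⟫ := fun h => hac <|
      Subtype.ext (sub_eq_zero.1 (inner_self_eq_zero (𝕜 := ℝ).1
        ((inner_sub_right _ _ _).trans (sub_eq_zero.2 h))))
    exact (hA ⟨_, hd⟩).orthogonalFamily_eigenspaces.pairwise hne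
      (Module.End.mem_eigenspace_iff.2 (mem_curvatureSpace.1 hu _ hd)) w
      (Module.End.mem_eigenspace_iff.2 (mem_curvatureSpace.1 hw _ hd))
  have hsup : iSup V = ⊤ := by
    rw [eq_top_iff, ← LinearMap.IsSymmetric.iSup_iInf_eq_top_of_commute hA hC]
    refine iSup_le fun χ u hu => ?_
    by_cases hu0 : u = 0
    · rw [hu0]; exact Submodule.zero_mem _
    -- the weight `χ` is linear: it is the inner product with a normal vector
    have huA : ∀ v, A v u = χ v • u := fun v =>
      Module.End.mem_eigenspace_iff.1 ((Submodule.mem_iInf _).1 hu v)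
    have huu : ⟪u, u⟫ ≠ 0 := fun h => hu0 (inner_self_eq_zero.1 h)
    let w : 𝔼 := (normalSpace M x).starProjection ((⟪u, u⟫)⁻¹ • fderiv ℝ (fderiv ℝ π) x u u)
    have hw : w ∈ normalSpace M x := Submodule.starProjection_apply_mem _ _
    have hχ : ∀ v, χ v = ⟪(v : 𝔼), w⟫ := by
      intro v
      have h1 := R.inner_shapeOperator hxO v.2 u u
      have h2 : ⟪A v u, u⟫ = χ v * ⟪u, u⟫ := by rw [huA]; exact real_inner_smul_left u u (χ v)
      have h3 : ⟪(v : 𝔼), w⟫ = ⟪(v : 𝔼), (⟪u, u⟫)⁻¹ • fderiv ℝ (fderiv ℝ π) x u u⟫ := by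
        rw [← Submodule.inner_starProjection_left_eq_right,
          Submodule.starProjection_eq_self_iff.2 v.2]
      rw [h3, inner_smul_right, ← h1]
      change _ = _ * ⟪A v u, u⟫
      rw [h2]
      field_simp
    have huw : u ∈ curvatureSpace M x w := by
      rw [mem_curvatureSpace]
      intro v hv
      rw [← hχ ⟨v, hv⟩]
      exact huA ⟨v, hv⟩
    have hwC : w ∈ curvatureNormals M x :=
      mem_curvatureNormals.2 ⟨hw, fun h => hu0 ((Submodule.mem_bot ℝ).1 (h ▸ huw))⟩
    exact Submodule.mem_iSup_of_mem (p := V) ⟨w, hwC⟩ huw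
  have hInt : DirectSum.IsInternal V := by
    rw [hOF.isInternal_iff, hsup, Submodule.top_orthogonal_eq_bot]
  have hn := hM.submanifold.finrank_tangentSpace hx
  refine ⟨hInt.subordinateOrthonormalBasis hn hOF,
    fun i => (hInt.subordinateOrthonormalBasisIndex hn i hOF : {w // w ∈ curvatureNormals M x}),
    fun i => ?_, fun v hv i => ?_⟩
  · exact (mem_curvatureNormals.1 (hInt.subordinateOrthonormalBasisIndex hn i hOF).2).1
  · exact mem_curvatureSpace.1 (hInt.subordinateOrthonormalBasis_subordinate hn i hOF) v hv

namespace IsPrincipalFrame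

variable {n : ℕ} {M : Set (EuclideanSpace ℝ (Fin N))} {x : EuclideanSpace ℝ (Fin N)}
  {b : OrthonormalBasis (Fin n) ℝ (tangentSpace M x)} {ν : Fin n → EuclideanSpace ℝ (Fin N)}

theorem repr_shapeOperator (h : IsPrincipalFrame M x b ν) (hM : IsSubmanifold n M) (hx : x ∈ M)
    {v : 𝔼} (hv : v ∈ normalSpace M x) (u : tangentSpace M x) (i : Fin n) :
    b.toBasis.repr (shapeOperator M x v u) i = ⟪v, ν i⟫ * b.toBasis.repr u i := by
  simp only [OrthonormalBasis.coe_toBasis_repr_apply, OrthonormalBasis.repr_apply_apply]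
  rw [← hM.shapeOperator_isSymmetric hx hv, h.apply v hv]
  exact real_inner_smul_left (b i) u _

theorem finrank_eigenspace (h : IsPrincipalFrame M x b ν) (hM : IsSubmanifold n M) (hx : x ∈ M)
    {v : 𝔼} (hv : v ∈ normalSpace M x) (c : ℝ) :
    Module.finrank ℝ ((shapeOperator M x v).eigenspace c) =
      (Finset.univ.filter fun i => ⟪v, ν i⟫ = c).card := by
  refine finrank_eq_card_of_mem_iff b.toBasis _ _ fun u => ?_
  rw [Module.End.mem_eigenspace_iff, b.toBasis.ext_elem_iff]
  refine forall_congr' fun i => ?_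
  rw [h.repr_shapeOperator hM hx hv]
  simp only [map_smul, Finsupp.smul_apply, smul_eq_mul, Finset.mem_filter, Finset.mem_univ,
    true_and]
  rw [← sub_eq_zero, ← sub_mul, mul_eq_zero, sub_eq_zero, or_iff_not_imp_left]

theorem multiplicity_eq (h : IsPrincipalFrame M x b ν) (hM : IsSubmanifold n M) (hx : x ∈ M)
    {w : 𝔼} (hw : w ∈ normalSpace M x) :
    multiplicity M x w = (Finset.univ.filter fun i => ν i = w).card := by
  refine finrank_eq_card_of_mem_iff b.toBasis _ _ fun u => ?_
  simp only [Finset.mem_filter, Finset.mem_univ, true_and]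
  have key : ∀ v ∈ normalSpace M x, (shapeOperator M x v u = ⟪v, w⟫ • u ↔
      ∀ i, ⟪v, ν i - w⟫ * b.toBasis.repr u i = 0) := by
    intro v hv
    rw [b.toBasis.ext_elem_iff]
    refine forall_congr' fun i => ?_
    rw [h.repr_shapeOperator hM hx hv, inner_sub_right, sub_mul, sub_eq_zero]
    simp
  rw [mem_curvatureSpace]
  constructor
  · intro hu i hi
    have hd : ν i - w ∈ normalSpace M x := Submodule.sub_mem _ (h.normal i) hw
    have := (key _ hd).1 (hu _ hd) i
    exact (mul_eq_zero.1 this).resolve_left fun h0 => hi (sub_eq_zero.1 (inner_self_eq_zero.1 h0))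
  · intro hu v hv
    refine (key v hv).2 fun i => ?_
    by_cases hi : ν i = w
    · rw [hi, sub_self, inner_zero_right, zero_mul]
    · rw [hu i hi, mul_zero]

theorem mem_curvatureNormals_iff (h : IsPrincipalFrame M x b ν) (hM : IsSubmanifold n M)
    (hx : x ∈ M) {w : 𝔼} : w ∈ curvatureNormals M x ↔ ∃ i, ν i = w := by
  have key : w ∈ normalSpace M x → (curvatureSpace M x w = ⊥ ↔ ¬ ∃ i, ν i = w) := by
    intro hw
    rw [← Submodule.finrank_eq_zero (R := ℝ)]
    change multiplicity M x w = 0 ↔ _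
    rw [h.multiplicity_eq hM hx hw, Finset.card_eq_zero, Finset.filter_eq_empty_iff]
    simp
  rw [mem_curvatureNormals]
  constructor
  · rintro ⟨hw, hne⟩
    by_contra hc
    exact hne ((key hw).2 hc)
  · rintro ⟨i, rfl⟩
    exact ⟨h.normal i, fun hc => (key (h.normal i)).1 hc ⟨i, rfl⟩⟩

/-- Sums over the curvature normals with multiplicities are sums over a principal frame. -/
theorem sum_curvatureNormals (h : IsPrincipalFrame M x b ν) (hM : IsSubmanifold n M) (hx : x ∈ M)
    {F : Type*} [AddCommGroup F] [Module ℝ F] (G : 𝔼 → F) :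
    ∑ w ∈ curvatureNormals M x, (multiplicity M x w : ℝ) • G w = ∑ i, G (ν i) := by
  classical
  have himg : curvatureNormals M x = Finset.univ.image ν := by
    ext w
    rw [h.mem_curvatureNormals_iff hM hx]
    simp
  rw [Finset.sum_comp, himg]
  refine Finset.sum_congr rfl fun w hw => ?_
  obtain ⟨i, -, rfl⟩ := Finset.mem_image.1 hw
  rw [h.multiplicity_eq hM hx (h.normal i), Nat.cast_smul_eq_nsmul]

end IsPrincipalFrame

/-- The right-hand side `∑ mᵢ nᵢ / (1 - ⟪z, nᵢ⟫)` of the flow equation at the point `x`. -/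
noncomputable def flowField (M : Set 𝔼) (x z : 𝔼) : 𝔼 :=
  ∑ w ∈ curvatureNormals M x, ((multiplicity M x w : ℝ) / (1 - ⟪z, w⟫)) • w

theorem IsPrincipalFrame.flowField_eq {n : ℕ} {M : Set 𝔼} {x : 𝔼}
    {b : OrthonormalBasis (Fin n) ℝ (tangentSpace M x)} {ν : Fin n → 𝔼}
    (h : IsPrincipalFrame M x b ν) (hM : IsSubmanifold n M) (hx : x ∈ M) (z : 𝔼) :
    flowField M x z = ∑ i, (1 - ⟪z, ν i⟫)⁻¹ • ν i := by
  rw [← h.sum_curvatureNormals hM hx fun w => (1 - ⟪z, w⟫)⁻¹ • w]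
  refine Finset.sum_congr rfl fun w _ => ?_
  rw [smul_smul, div_eq_mul_inv]

/-! ### Parallel transport in the normal bundle -/

/-- A function on a connected piece of a submanifold with vanishing differential is constant. -/
theorem IsSubmanifold.eq_of_fderivWithin_eq_zero {n : ℕ} {M U : Set 𝔼} (hM : IsSubmanifold n M)
    (hU : IsOpen U) (hc : IsPreconnected (M ∩ U)) {g : 𝔼 → ℝ} (hg : ContDiffOn ℝ ∞ g (M ∩ U))
    (h0 : ∀ x ∈ M ∩ U, ∃ g' : 𝔼 →L[ℝ] ℝ, HasFDerivWithinAt g g' M x ∧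
      ∀ v ∈ tangentSpace M x, g' v = 0) {x y : 𝔼} (hx : x ∈ M ∩ U) (hy : y ∈ M ∩ U) :
    g x = g y := by
  refine hc.induction₂ (fun a b => g a = g b) ?_ (fun a b c _ _ _ h1 h2 => h1.trans h2)
    (fun a b _ _ h1 => h1.symm) hx hy
  intro a ha
  obtain ⟨O₀, π, R₀, haO₀, -⟩ := hM.exists_isRetraction ha.1
  have R := R₀.restrict hU
  have haO := R₀.mem_restrict haO₀ ha.2
  have hsub : M ∩ (U ∩ (O₀ ∩ π ⁻¹' U)) ⊆ M ∩ U := fun y hy => ⟨hy.1, hy.2.1⟩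
  set O := U ∩ (O₀ ∩ π ⁻¹' U)
  have hgs := hg.mono hsub
  set G : 𝔼 → ℝ := fun y => g (π y) with hG
  have hd : ∀ y ∈ O, HasFDerivAt G (fderiv ℝ G y) y := fun y hy => R.hasFDerivAt_comp hgs hy
  have hcomp : ∀ y ∈ O, fderiv ℝ G y = (fderiv ℝ G (π y)) ∘L (fderiv ℝ π y) := by
    intro y hy
    have h1 := (hd (π y) (R.mapsTo y hy).2).comp y (R.hasFDerivAt hy)
    have h2 := (hd y hy).congr_of_eventuallyEq (f₁ := G ∘ π) (by
      filter_upwards [R.isOpen.mem_nhds hy] with z hz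
      simp only [hG, Function.comp, R.fix _ (R.mapsTo z hz)])
    exact h2.unique h1
  have hzeroM : ∀ y ∈ M ∩ O, fderiv ℝ G y = 0 := by
    intro y hy
    rw [hcomp y hy.2, R.fix y hy]
    ext v
    obtain ⟨g', hg', hg0⟩ := h0 y (hsub hy)
    have hv := R.fderiv_apply_mem hy v
    have := fderiv_unique_on_tangentSpace (R.hasFDerivWithinAt_fderiv_comp hgs hy) hg' hv
    rw [ContinuousLinearMap.comp_apply, this, hg0 _ hv]
    rfl
  have hzero : ∀ y ∈ O, fderiv ℝ G y = 0 := fun y hy => by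
    rw [hcomp y hy, hzeroM _ (R.mapsTo y hy), ContinuousLinearMap.zero_comp]
  obtain ⟨r, hr, hball⟩ := Metric.isOpen_iff.1 R.isOpen a haO.2
  have hconst : ∀ y ∈ Metric.ball a r, G a = G y := fun y hy =>
    Metric.isOpen_ball.is_const_of_fderiv_eq_zero (convex_ball a r).isPreconnected
      (fun z hz => (hd z (hball hz)).differentiableAt.differentiableWithinAt)
      (fun z hz => hzero z (hball hz)) (Metric.mem_ball_self hr) hy
  filter_upwards [self_mem_nhdsWithin,
    mem_nhdsWithin_of_mem_nhds (Metric.ball_mem_nhds a hr)] with y hyM hyb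
  have := hconst y hyb
  simpa only [hG, R.fix a haO, R.fix y ⟨hyM.1, hball hyb⟩] using this

/-- Parallel transport in the normal bundle from `p` to the nearby points of `M`, in the form of
linear maps `τ y` which carry `ν_p M` isometrically onto `ν_y M`. -/
structure IsParallelTransport (M U : Set 𝔼) (p : 𝔼) (τ : 𝔼 → 𝔼 →L[ℝ] 𝔼) : Prop where
  isOpen : IsOpen U
  mem : p ∈ M ∩ U
  isPreconnected : IsPreconnected (M ∩ U)
  smooth : ContDiffOn ℝ ∞ τ (M ∩ U)
  parallel : ∀ v ∈ normalSpace M p, IsParallelNormalField M (M ∩ U) fun y => τ y v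
  base : ∀ v ∈ normalSpace M p, τ p v = v
  inner : ∀ y ∈ M ∩ U, ∀ v ∈ normalSpace M p, ∀ w ∈ normalSpace M p, ⟪τ y v, τ y w⟫ = ⟪v, w⟫
  surj : ∀ y ∈ M ∩ U, ∀ w ∈ normalSpace M y, ∃ v ∈ normalSpace M p, τ y v = w

/-- Inner products of parallel normal fields are constant. -/
theorem IsParallelNormalField.inner_eq {n : ℕ} {M U : Set 𝔼} (hM : IsSubmanifold n M)
    (hU : IsOpen U) (hc : IsPreconnected (M ∩ U)) {η ζ : 𝔼 → 𝔼}
    (hη : IsParallelNormalField M (M ∩ U) η) (hζ : IsParallelNormalField M (M ∩ U) ζ) {x y : 𝔼}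
    (hx : x ∈ M ∩ U) (hy : y ∈ M ∩ U) : ⟪η x, ζ x⟫ = ⟪η y, ζ y⟫ := by
  refine hM.eq_of_fderivWithin_eq_zero (g := fun y => ⟪η y, ζ y⟫) hU hc
    (hη.smooth.inner ℝ hζ.smooth) (fun z hz => ?_) hx hy
  refine ⟨_, (hη.hasFDerivWithinAt hU hz).inner ℝ (hζ.hasFDerivWithinAt hU hz), fun v hv => ?_⟩
  simp only [fderivInnerCLM_apply, ContinuousLinearMap.comp_apply, ContinuousLinearMap.prod_apply]
  rw [inner_normal_tangent (hζ.parallel z hz v hv) (hη.normal z hz),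
    inner_tangent_normal (hη.parallel z hz v hv) (hζ.normal z hz), add_zero]

theorem IsSubmanifold.finrank_normalSpace {n : ℕ} {M : Set 𝔼} (hM : IsSubmanifold n M) {p : 𝔼}
    (hp : p ∈ M) : n + Module.finrank ℝ (normalSpace M p) = N := by
  have h := Submodule.finrank_add_finrank_orthogonal (tangentSpace M p)
  rw [hM.finrank_tangentSpace hp, finrank_euclideanSpace_fin] at h
  exact h

/-- Local flatness extends an orthonormal basis of `ν_p M` to parallel normal fields. These stay
orthonormal, and hence span the normal spaces, because inner products of parallel fields are
constant. -/
theorem IsIsoparametric.exists_isParallelTransport {n : ℕ} {M : Set 𝔼} (hM : IsIsoparametric n M)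
    {p : 𝔼} (hp : p ∈ M) : ∃ U τ, IsParallelTransport M U p τ := by
  set e := stdOrthonormalBasis ℝ (normalSpace M p) with he
  have hflat := fun i => hM.flat p hp (e i) (e i).2
  choose V η hV hpV hη hηp using hflat
  obtain ⟨U, hU, hpU, hUV, hconn⟩ := hM.submanifold.exists_isOpen_isPreconnected hp
    (isOpen_iInter_of_finite hV) (Set.mem_iInter.2 hpV)
  have hη' : ∀ i, IsParallelNormalField M (M ∩ U) (η i) := fun i => (hη i).mono
    (Set.inter_subset_inter_right _ (hUV.trans (Set.iInter_subset _ i)))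
  set τ : 𝔼 → 𝔼 →L[ℝ] 𝔼 := fun y => ∑ i, (innerSL ℝ (e i : 𝔼)).smulRight (η i y) with hτ
  have hτa : ∀ y v, τ y v = ∑ i, ⟪(e i : 𝔼), v⟫ • η i y := fun y v => by
    simp [hτ]
  have hpar : ∀ v ∈ normalSpace M p, IsParallelNormalField M (M ∩ U) fun y => τ y v := by
    intro v hv
    simp only [hτa]
    refine ⟨?_, fun y hy => ?_, fun y hy u hu => ?_⟩
    · exact ContDiffOn.sum fun i _ => (hη' i).smooth.const_smul _
    · exact Submodule.sum_mem _ fun i _ => Submodule.smul_mem _ _ ((hη' i).normal y hy)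
    · have hd : HasFDerivWithinAt (fun y => ∑ i, ⟪(e i : 𝔼), v⟫ • η i y)
          (∑ i, ⟪(e i : 𝔼), v⟫ • diff M (η i) y) M y :=
        HasFDerivWithinAt.fun_sum fun i _ => ((hη' i).hasFDerivWithinAt hU hy).fun_const_smul _
      have := fderiv_unique_on_tangentSpace hd.differentiableWithinAt.hasFDerivWithinAt hd hu
      rw [diff, this, sum_apply]
      exact Submodule.sum_mem _ fun i _ => Submodule.smul_mem _ _ ((hη' i).parallel y hy u hu)
  have hbase : ∀ v ∈ normalSpace M p, τ p v = v := by
    intro v hv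
    have h := e.sum_repr' ⟨v, hv⟩
    have h2 := congrArg Subtype.val h
    rw [hτa]
    simp only [hηp]
    simpa using h2
  have hinner : ∀ y ∈ M ∩ U, ∀ v ∈ normalSpace M p, ∀ w ∈ normalSpace M p,
      ⟪τ y v, τ y w⟫ = ⟪v, w⟫ := by
    intro y hy v hv w hw
    have h := (hpar v hv).inner_eq hM.submanifold hU hconn (hpar w hw) hy ⟨hp, hpU⟩
    simpa only [hbase v hv, hbase w hw] using h
  refine ⟨U, τ, hU, ⟨hp, hpU⟩, hconn, ?_, hpar, hbase, hinner, fun y hy w hw => ?_⟩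
  · refine ContDiffOn.sum fun i _ => ?_
    exact ((ContinuousLinearMap.smulRightL ℝ 𝔼 𝔼 (innerSL ℝ (e i : 𝔼))).contDiff).comp_contDiffOn
      (hη' i).smooth
  · let L : normalSpace M p →ₗ[ℝ] normalSpace M y :=
      ((τ y).toLinearMap ∘ₗ (normalSpace M p).subtype).codRestrict _
        fun v => (hpar v v.2).normal y hy
    have hL : Function.Injective L := by
      rw [injective_iff_map_eq_zero]
      intro v hv
      have h1 : τ y v = 0 := congrArg Subtype.val hv
      have h2 := hinner y hy v v.2 v v.2
      rw [h1, inner_zero_left] at h2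
      exact Subtype.ext (inner_self_eq_zero.1 h2.symm)
    have hfr : Module.finrank ℝ (normalSpace M p) = Module.finrank ℝ (normalSpace M y) := by
      have h1 := hM.submanifold.finrank_normalSpace hp
      have h2 := hM.submanifold.finrank_normalSpace hy.1
      omega
    obtain ⟨v, hv⟩ := (LinearMap.injective_iff_surjective_of_finrank_eq_finrank hfr).1 hL ⟨w, hw⟩
    exact ⟨v, v.2, congrArg Subtype.val hv⟩

/-- Finitely many nonzero vectors of a subspace are all detected by one vector of the subspace. -/
theorem exists_forall_inner_ne_zero {ι : Type*} [Finite ι] (K : Submodule ℝ 𝔼) (w : ι → 𝔼)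
    (hK : ∀ i, w i ∈ K) (hw : ∀ i, w i ≠ 0) : ∃ v ∈ K, ∀ i, ⟪v, w i⟫ ≠ 0 := by
  obtain ⟨φ, hφ⟩ := Module.exists_dual_forall_apply_ne_zero (K := ℝ)
    (fun i => (⟨w i, hK i⟩ : K)) fun i h => hw i (congrArg Subtype.val h)
  refine ⟨((InnerProductSpace.toDual ℝ K).symm (LinearMap.toContinuousLinearMap φ) : K),
    Submodule.coe_mem _, fun i => ?_⟩
  have h : ⟪(InnerProductSpace.toDual ℝ K).symm (LinearMap.toContinuousLinearMap φ),
      (⟨w i, hK i⟩ : K)⟫ = φ ⟨w i, hK i⟩ := InnerProductSpace.toDual_symm_apply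
  rw [Submodule.coe_inner] at h
  rw [h]
  exact hφ i

namespace IsParallelTransport

variable {n : ℕ} {M U : Set (EuclideanSpace ℝ (Fin N))} {p y z : EuclideanSpace ℝ (Fin N)}
  {τ : EuclideanSpace ℝ (Fin N) → EuclideanSpace ℝ (Fin N) →L[ℝ] EuclideanSpace ℝ (Fin N)}

theorem normal (h : IsParallelTransport M U p τ) (hy : y ∈ M ∩ U) (hz : z ∈ normalSpace M p) :
    τ y z ∈ normalSpace M y := (h.parallel z hz).normal y hy

/-- Parallel transport preserves the multiplicities of the curvature normals: the constancy of the
principal curvatures along parallel fields determines them, since a suitable normal vector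
separates the curvature normals. -/
theorem multiplicity_eq (h : IsParallelTransport M U p τ) (hM : IsIsoparametric n M)
    (hy : y ∈ M ∩ U) (hz : z ∈ normalSpace M p) :
    multiplicity M y (τ y z) = multiplicity M p z := by
  obtain ⟨b, ν, hν⟩ := hM.exists_isPrincipalFrame h.mem.1
  obtain ⟨b', ν', hν'⟩ := hM.exists_isPrincipalFrame hy.1
  choose w hw hwν using fun i => h.surj y hy (ν' i) (hν'.normal i)
  have hcard : ∀ v ∈ normalSpace M p, ∀ c : ℝ,
      (Finset.univ.filter fun i => ⟪v, ν i⟫ = c).card =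
        (Finset.univ.filter fun i => ⟪v, w i⟫ = c).card := by
    intro v hv c
    have h1 := hM.constant U (fun y => τ y v) h.isOpen h.isPreconnected (h.parallel v hv)
      p h.mem y hy c
    beta_reduce at h1
    rw [h.base v hv] at h1
    rw [hν.finrank_eigenspace hM.submanifold h.mem.1 hv,
      hν'.finrank_eigenspace hM.submanifold hy.1 (h.normal hy hv)] at h1
    rw [h1]
    congr 1
    ext i
    rw [Finset.mem_filter_univ, Finset.mem_filter_univ, ← hwν i, h.inner y hy v hv _ (hw i)]
  obtain ⟨v, hv, hsep⟩ := exists_forall_inner_ne_zero (normalSpace M p)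
    (Sum.elim (fun i : {i // ν i ≠ z} => ν i - z) (fun i : {i // w i ≠ z} => w i - z))
    (by rintro (i | i)
        · exact Submodule.sub_mem _ (hν.normal i) hz
        · exact Submodule.sub_mem _ (hw i) hz)
    (by rintro (i | i)
        · exact sub_ne_zero.2 i.2
        · exact sub_ne_zero.2 i.2)
  rw [hν.multiplicity_eq hM.submanifold h.mem.1 hz,
    hν'.multiplicity_eq hM.submanifold hy.1 (h.normal hy hz)]
  have e1 : (Finset.univ.filter fun i => ν i = z) =
      Finset.univ.filter fun i => ⟪v, ν i⟫ = ⟪v, z⟫ := by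
    ext i
    simp only [Finset.mem_filter, Finset.mem_univ, true_and]
    refine ⟨fun hi => by rw [hi], fun hi => ?_⟩
    by_contra hne
    refine hsep (Sum.inl ⟨i, hne⟩) ?_
    simp only [Sum.elim_inl, inner_sub_right, hi, sub_self]
  have e2 : (Finset.univ.filter fun i => ν' i = τ y z) =
      Finset.univ.filter fun i => ⟪v, w i⟫ = ⟪v, z⟫ := by
    ext i
    simp only [Finset.mem_filter, Finset.mem_univ, true_and]
    refine ⟨fun hi => ?_, fun hi => ?_⟩
    · rw [← h.inner y hy v hv _ (hw i), hwν, hi, h.inner y hy v hv z hz]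
    · by_contra hne
      have hne' : w i ≠ z := fun hc => hne (by rw [← hwν i, hc])
      refine hsep (Sum.inr ⟨i, hne'⟩) ?_
      simp only [Sum.elim_inr, inner_sub_right, hi, sub_self]
  rw [e1, e2, hcard v hv]

theorem injOn (h : IsParallelTransport M U p τ) (hy : y ∈ M ∩ U) :
    Set.InjOn (τ y) (normalSpace M p : Set 𝔼) := by
  intro a ha c hc hac
  have hd := Submodule.sub_mem _ ha hc
  have h1 := h.inner y hy _ hd _ hd
  rw [map_sub, hac, sub_self, inner_zero_left] at h1
  exact sub_eq_zero.1 (inner_self_eq_zero.1 h1.symm)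

theorem mem_curvatureNormals_iff (h : IsParallelTransport M U p τ) (hM : IsIsoparametric n M)
    (hy : y ∈ M ∩ U) (hz : z ∈ normalSpace M p) :
    τ y z ∈ curvatureNormals M y ↔ z ∈ curvatureNormals M p := by
  have h1 := h.multiplicity_eq hM hy hz
  rw [mem_curvatureNormals, mem_curvatureNormals, Ne, Ne, ← Submodule.finrank_eq_zero (R := ℝ),
    ← Submodule.finrank_eq_zero (R := ℝ)]
  change _ ∧ ¬ multiplicity M y (τ y z) = 0 ↔ _ ∧ ¬ multiplicity M p z = 0
  rw [h1]
  exact and_congr_left fun _ => ⟨fun _ => hz, fun _ => h.normal hy hz⟩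

open Classical in
theorem curvatureNormals_eq (h : IsParallelTransport M U p τ) (hM : IsIsoparametric n M)
    (hy : y ∈ M ∩ U) : curvatureNormals M y = (curvatureNormals M p).image (τ y) := by
  ext w
  rw [Finset.mem_image]
  constructor
  · intro hw
    obtain ⟨v, hv, rfl⟩ := h.surj y hy w (mem_curvatureNormals.1 hw).1
    exact ⟨v, (h.mem_curvatureNormals_iff hM hy hv).1 hw, rfl⟩
  · rintro ⟨v, hv, rfl⟩
    exact (h.mem_curvatureNormals_iff hM hy (mem_curvatureNormals.1 hv).1).2 hv

theorem flowField_eq (h : IsParallelTransport M U p τ) (hM : IsIsoparametric n M)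
    (hy : y ∈ M ∩ U) (hz : z ∈ normalSpace M p) :
    flowField M y (τ y z) = τ y (flowField M p z) := by
  classical
  have hn : ∀ w ∈ curvatureNormals M p, w ∈ normalSpace M p :=
    fun w hw => (mem_curvatureNormals.1 hw).1
  rw [flowField, h.curvatureNormals_eq hM hy, Finset.sum_image
    fun a ha c hc hac => h.injOn hy (hn a ha) (hn c hc) hac, flowField, map_sum]
  refine Finset.sum_congr rfl fun w hw => ?_
  rw [h.multiplicity_eq hM hy (hn w hw), h.inner y hy z hz w (hn w hw), map_smul]

theorem chamber_iff (h : IsParallelTransport M U p τ) (hM : IsIsoparametric n M)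
    (hy : y ∈ M ∩ U) (hz : z ∈ normalSpace M p) :
    (∀ w ∈ curvatureNormals M y, ⟪τ y z, w⟫ < 1) ↔ ∀ w ∈ curvatureNormals M p, ⟪z, w⟫ < 1 := by
  classical
  rw [h.curvatureNormals_eq hM hy, Finset.forall_mem_image]
  refine forall₂_congr fun w hw => ?_
  rw [h.inner y hy z hz w (mem_curvatureNormals.1 hw).1]

end IsParallelTransport

theorem flowField_mem (M : Set 𝔼) (x z : 𝔼) : flowField M x z ∈ normalSpace M x :=
  Submodule.sum_mem _ fun _ hw => Submodule.smul_mem _ _ (mem_curvatureNormals.1 hw).1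

theorem IsFlowSolution.transport {n : ℕ} {M U : Set 𝔼} {p y : 𝔼} {τ : 𝔼 → 𝔼 →L[ℝ] 𝔼}
    {T : ℝ} {ξ : ℝ → 𝔼} (hξ : IsFlowSolution M p T ξ) (h : IsParallelTransport M U p τ)
    (hM : IsIsoparametric n M) (hy : y ∈ M ∩ U) : IsFlowSolution M y T fun t => τ y (ξ t) where
  initial := by rw [hξ.initial, map_zero]
  normal := fun t ht => h.normal hy (hξ.normal t ht)
  chamber := fun t ht => (h.chamber_iff hM hy (hξ.normal t ht)).2 (hξ.chamber t ht)
  flow := fun t ht => by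
    have h1 := (τ y).hasFDerivAt.comp_hasDerivWithinAt t (hξ.flow t ht)
    change HasDerivWithinAt (fun t => τ y (ξ t)) (flowField M y (τ y (ξ t))) _ _
    rw [h.flowField_eq hM hy (hξ.normal t ht)]
    exact h1

/-- Parallel transport also carries solutions back to the base point. -/
theorem IsFlowSolution.transport_symm {n : ℕ} {M U : Set 𝔼} {p y : 𝔼} {τ : 𝔼 → 𝔼 →L[ℝ] 𝔼}
    {T : ℝ} {ξ : ℝ → 𝔼} (hξ : IsFlowSolution M y T ξ) (h : IsParallelTransport M U p τ)
    (hM : IsIsoparametric n M) (hy : y ∈ M ∩ U) : ∃ ζ, IsFlowSolution M p T ζ := by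
  set σ : 𝔼 →L[ℝ] 𝔼 := (normalSpace M p).starProjection ∘L ContinuousLinearMap.adjoint (τ y)
    with hσ
  have hσn : ∀ w, σ w ∈ normalSpace M p := fun w => Submodule.starProjection_apply_mem _ _
  -- `σ` inverts the isometry `τ y`
  have hστ : ∀ v ∈ normalSpace M p, σ (τ y v) = v := by
    intro v hv
    have hd : σ (τ y v) - v ∈ normalSpace M p := Submodule.sub_mem _ (hσn _) hv
    refine sub_eq_zero.1 (inner_self_eq_zero (𝕜 := ℝ).1 ?_)
    have h1 : ⟪σ (τ y v), σ (τ y v) - v⟫ = ⟪v, σ (τ y v) - v⟫ := by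
      rw [← h.inner y hy v hv _ hd, ← ContinuousLinearMap.adjoint_inner_left]
      change ⟪(normalSpace M p).starProjection _, _⟫ = _
      rw [Submodule.inner_starProjection_left_eq_right,
        Submodule.starProjection_eq_self_iff.2 hd]
      rfl
    rw [inner_sub_left, h1, sub_self]
  have hτσ : ∀ w ∈ normalSpace M y, τ y (σ w) = w := by
    intro w hw
    obtain ⟨v, hv, rfl⟩ := h.surj y hy w hw
    rw [hστ v hv]
  refine ⟨fun t => σ (ξ t), by simp only [hξ.initial, map_zero], fun t _ => hσn _, fun t ht => ?_,
    fun t ht => ?_⟩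
  · rw [← h.chamber_iff hM hy (hσn _), hτσ _ (hξ.normal t ht)]
    exact hξ.chamber t ht
  · have h1 := σ.hasFDerivAt.comp_hasDerivWithinAt t (hξ.flow t ht)
    change HasDerivWithinAt (fun t => σ (ξ t)) (flowField M p (σ (ξ t))) _ _
    have h2 : σ (flowField M y (ξ t)) = flowField M p (σ (ξ t)) := by
      rw [← hστ _ (flowField_mem M p _), ← h.flowField_eq hM hy (hσn _), hτσ _ (hξ.normal t ht)]
    rw [← h2]
    exact h1

/-! ### The flow equation -/

/-- The open convex set of all `z` with `⟪z, nᵢ⟫ < 1` for all `i`, in which the flow field is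
smooth. -/
def chamber (M : Set 𝔼) (x : 𝔼) : Set 𝔼 :=
  {z | ∀ w ∈ curvatureNormals M x, ⟪z, w⟫ < 1}

theorem isOpen_chamber (M : Set 𝔼) (x : 𝔼) : IsOpen (chamber M x) := by
  have : chamber M x = ⋂ w ∈ curvatureNormals M x, {z : 𝔼 | ⟪z, w⟫ < 1} := by
    ext z; simp [chamber]
  rw [this]
  exact isOpen_biInter_finset fun w _ =>
    isOpen_lt (continuous_id.inner continuous_const) continuous_const

theorem contDiffOn_flowField (M : Set 𝔼) (x : 𝔼) :
    ContDiffOn ℝ ∞ (flowField M x) (chamber M x) := by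
  refine ContDiffOn.sum fun w hw => ?_
  have h1 : ContDiffOn ℝ ∞ (fun z : 𝔼 => 1 - ⟪z, w⟫) (chamber M x) :=
    (contDiff_const.sub (contDiff_id.inner ℝ contDiff_const)).contDiffOn
  have h2 : ContDiffOn ℝ ∞ (fun z : 𝔼 => (multiplicity M x w : ℝ) / (1 - ⟪z, w⟫)) (chamber M x) :=
    contDiffOn_const.fun_div h1 fun z hz => ne_of_gt (sub_pos.2 (hz w hw))
  exact h2.smul contDiffOn_const

theorem hasDerivWithinAt_Ici_of_Ico {F : Type*} [NormedAddCommGroup F] [NormedSpace ℝ F]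
    {f : ℝ → F} {f' : F} {T t : ℝ} (ht : t ∈ Set.Ico 0 T)
    (h : HasDerivWithinAt f f' (Set.Ico 0 T) t) : HasDerivWithinAt f f' (Set.Ici t) t := by
  refine h.mono_of_mem_nhdsWithin ?_
  filter_upwards [self_mem_nhdsWithin, mem_nhdsWithin_of_mem_nhds (Iio_mem_nhds ht.2)] with s h1 h2
  exact ⟨ht.1.trans h1, h2⟩

namespace IsFlowSolution

variable {M : Set (EuclideanSpace ℝ (Fin N))} {x : EuclideanSpace ℝ (Fin N)} {T T' : ℝ}
  {ξ ξ' : ℝ → EuclideanSpace ℝ (Fin N)}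

theorem hasDerivWithinAt (h : IsFlowSolution M x T ξ) {t : ℝ} (ht : t ∈ Set.Ico 0 T) :
    HasDerivWithinAt ξ (flowField M x (ξ t)) (Set.Ico 0 T) t := h.flow t ht

theorem continuousOn (h : IsFlowSolution M x T ξ) : ContinuousOn ξ (Set.Ico 0 T) :=
  fun _ ht => (h.hasDerivWithinAt ht).continuousWithinAt

theorem mono (h : IsFlowSolution M x T ξ) (hT : T' ≤ T) : IsFlowSolution M x T' ξ where
  initial := h.initial
  normal := fun t ht => h.normal t ⟨ht.1, ht.2.trans_le hT⟩
  chamber := fun t ht => h.chamber t ⟨ht.1, ht.2.trans_le hT⟩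
  flow := fun t ht => (h.flow t ⟨ht.1, ht.2.trans_le hT⟩).mono (Set.Ico_subset_Ico_right hT)

/-- On a compact time interval a solution keeps a positive distance to each wall. -/
theorem exists_inner_le (h : IsFlowSolution M x T ξ) {t : ℝ} (ht : t ∈ Set.Ico 0 T) {w : 𝔼}
    (hw : w ∈ curvatureNormals M x) : ∃ c < 1, ∀ s ∈ Set.Icc 0 t, ⟪ξ s, w⟫ ≤ c := by
  have hsub : Set.Icc 0 t ⊆ Set.Ico 0 T := fun _ hs => ⟨hs.1, hs.2.trans_lt ht.2⟩
  obtain ⟨s, hs, hmax⟩ := isCompact_Icc.exists_isMaxOn (Set.nonempty_Icc.2 ht.1)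
    ((h.continuousOn.mono hsub).inner continuousOn_const (g := fun _ => w) (𝕜 := ℝ))
  exact ⟨_, h.chamber s (hsub hs) w hw, hmax⟩

theorem exists_norm_le (h : IsFlowSolution M x T ξ) {t : ℝ} (ht : t ∈ Set.Ico 0 T) :
    ∃ c, ∀ s ∈ Set.Icc 0 t, ‖ξ s‖ ≤ c :=
  isCompact_Icc.exists_bound_of_continuousOn
    (h.continuousOn.mono fun _ hs => ⟨hs.1, hs.2.trans_lt ht.2⟩)

/-- Uniqueness of solutions. The flow field blows up at the walls of the chamber, so its Lipschitz
continuity is used on a compact convex set containing both solutions up to time `t`. -/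
theorem eq (h : IsFlowSolution M x T ξ) (h' : IsFlowSolution M x T' ξ') {t : ℝ}
    (ht : t ∈ Set.Ico 0 T) (ht' : t ∈ Set.Ico 0 T') : ξ t = ξ' t := by
  choose! c hc1 hc using fun w hw => h.exists_inner_le ht (w := w) hw
  choose! c' hc1' hc' using fun w hw => h'.exists_inner_le ht' (w := w) hw
  obtain ⟨B, hB⟩ := h.exists_norm_le ht
  obtain ⟨B', hB'⟩ := h'.exists_norm_le ht'
  set K : Set 𝔼 := Metric.closedBall 0 (max B B') ∩
    ⋂ w ∈ curvatureNormals M x, {z : 𝔼 | ⟪z, w⟫ ≤ max (c w) (c' w)} with hK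
  have hKc : IsCompact K := (isCompact_closedBall _ _).inter_right
    (isClosed_biInter fun w _ => isClosed_le (continuous_id.inner continuous_const)
      continuous_const)
  have hKv : Convex ℝ K := by
    refine (convex_closedBall _ _).inter (convex_iInter₂ fun w _ => ?_)
    refine convex_halfSpace_le ⟨fun a b => ?_, fun a b => ?_⟩ _
    · exact inner_add_left _ _ _
    · exact real_inner_smul_left _ _ _
  have hKch : K ⊆ MCFIso.chamber M x := fun z hz w hw =>
    lt_of_le_of_lt (Set.mem_iInter₂.1 hz.2 w hw) (max_lt (hc1 w hw) (hc1' w hw))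
  obtain ⟨L, hL⟩ := ((contDiffOn_flowField M x).mono hKch).exists_lipschitzOnWith
    (by simp) hKv hKc
  have hsub : Set.Icc 0 t ⊆ Set.Ico 0 T := fun s hs => ⟨hs.1, hs.2.trans_lt ht.2⟩
  have hsub' : Set.Icc 0 t ⊆ Set.Ico 0 T' := fun s hs => ⟨hs.1, hs.2.trans_lt ht'.2⟩
  refine ODE_solution_unique_of_mem_Icc_right (v := fun _ => flowField M x) (s := fun _ => K)
    (a := 0) (b := t) (K := L) (fun _ _ => hL) (h.continuousOn.mono hsub) ?_ ?_
    (h'.continuousOn.mono hsub') ?_ ?_ (h.initial.trans h'.initial.symm) ⟨ht.1, le_rfl⟩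
  · intro s hs
    have hs' := hsub (Set.Ico_subset_Icc_self hs)
    exact hasDerivWithinAt_Ici_of_Ico hs' (h.hasDerivWithinAt hs')
  · intro s hs
    have hs' := Set.Ico_subset_Icc_self hs
    refine ⟨?_, Set.mem_iInter₂.2 fun w hw => (hc w hw s hs').trans (le_max_left _ _)⟩
    rw [mem_closedBall_zero_iff]
    exact (hB s hs').trans (le_max_left _ _)
  · intro s hs
    have hs' := hsub' (Set.Ico_subset_Icc_self hs)
    exact hasDerivWithinAt_Ici_of_Ico hs' (h'.hasDerivWithinAt hs')
  · intro s hs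
    have hs' := Set.Ico_subset_Icc_self hs
    refine ⟨?_, Set.mem_iInter₂.2 fun w hw => (hc' w hw s hs').trans (le_max_right _ _)⟩
    rw [mem_closedBall_zero_iff]
    exact (hB' s hs').trans (le_max_right _ _)

theorem contDiffOn (h : IsFlowSolution M x T ξ) : ContDiffOn ℝ ∞ ξ (Set.Ico 0 T) := by
  intro t ht
  have ht1 : t < (t + T) / 2 := by linarith [ht.2]
  have hsub : Set.Icc 0 ((t + T) / 2) ⊆ Set.Ico 0 T := fun s hs =>
    ⟨hs.1, hs.2.trans_lt (by linarith [ht.2])⟩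
  have h1 : ContDiffOn ℝ ∞ ξ (Set.Icc 0 ((t + T) / 2)) :=
    ODE.contDiffOn_enat_Icc_of_hasDerivWithinAt (f := fun _ => flowField M x) (n := ⊤)
      (u := MCFIso.chamber M x)
      ((contDiffOn_flowField M x).comp contDiffOn_snd fun q hq => hq.2)
      (fun s hs => (h.hasDerivWithinAt (hsub hs)).mono hsub)
      (fun s hs => h.chamber s (hsub hs))
  refine (h1 t ⟨ht.1, ht1.le⟩).mono_of_mem_nhdsWithin ?_
  filter_upwards [self_mem_nhdsWithin, mem_nhdsWithin_of_mem_nhds (Iio_mem_nhds ht1)] with s h1 h2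
  exact ⟨h1.1, h2.le⟩

end IsFlowSolution

theorem flowField_starProjection (M : Set 𝔼) (x z : 𝔼) :
    flowField M x ((normalSpace M x).starProjection z) = flowField M x z := by
  refine Finset.sum_congr rfl fun w hw => ?_
  rw [Submodule.inner_starProjection_left_eq_right,
    Submodule.starProjection_eq_self_iff.2 (mem_curvatureNormals.1 hw).1]

theorem starProjection_mem_chamber {M : Set 𝔼} {x z : 𝔼} (hz : z ∈ chamber M x) :
    (normalSpace M x).starProjection z ∈ chamber M x := fun w hw => by
  rw [Submodule.inner_starProjection_left_eq_right,
    Submodule.starProjection_eq_self_iff.2 (mem_curvatureNormals.1 hw).1]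
  exact hz w hw

/-- Local integral curves of the flow field through a normal vector in the chamber; they stay normal
because the flow field only depends on the normal component. -/
theorem exists_integralCurve {M : Set 𝔼} {x z : 𝔼} (hz : z ∈ chamber M x)
    (hzn : z ∈ normalSpace M x) (t₀ : ℝ) :
    ∃ (α : ℝ → 𝔼) (ε : ℝ), 0 < ε ∧ α t₀ = z ∧ ∀ t ∈ Set.Ioo (t₀ - ε) (t₀ + ε),
      α t ∈ normalSpace M x ∧ α t ∈ chamber M x ∧ HasDerivAt α (flowField M x (α t)) t := by
  have hC : ContDiffAt ℝ 1 (flowField M x) z :=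
    ((contDiffOn_flowField M x).contDiffAt ((isOpen_chamber M x).mem_nhds hz)).of_le (by simp)
  obtain ⟨β, hβ, ε, hε, hd⟩ :=
    hC.exists_forall_mem_closedBall_exists_eq_forall_mem_Ioo_hasDerivAt₀ t₀
  have hcont : ContinuousAt β t₀ := (hd t₀ ⟨by linarith, by linarith⟩).continuousAt
  have hev : ∀ᶠ t in 𝓝 t₀, β t ∈ chamber M x :=
    hcont.eventually_mem ((isOpen_chamber M x).mem_nhds (by rwa [hβ]))
  obtain ⟨δ, hδ, hδβ⟩ := Metric.eventually_nhds_iff.1 hev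
  refine ⟨fun t => (normalSpace M x).starProjection (β t), min ε δ, lt_min hε hδ, ?_, ?_⟩
  · simp only [hβ]
    exact Submodule.starProjection_eq_self_iff.2 hzn
  · intro t ht
    have h1 : t ∈ Set.Ioo (t₀ - ε) (t₀ + ε) :=
      ⟨by linarith [ht.1, min_le_left ε δ], by linarith [ht.2, min_le_left ε δ]⟩
    have h2 : dist t t₀ < δ := by
      rw [Real.dist_eq, abs_lt]
      constructor <;> linarith [ht.1, ht.2, min_le_right ε δ]
    refine ⟨Submodule.starProjection_apply_mem _ _, starProjection_mem_chamber (hδβ h2), ?_⟩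
    have h3 := ((normalSpace M x).starProjection).hasFDerivAt.comp_hasDerivAt t (hd t h1)
    rw [flowField_starProjection]
    rw [Submodule.starProjection_eq_self_iff.2 (flowField_mem M x (β t))] at h3
    exact h3

theorem exists_isFlowSolution (M : Set 𝔼) (x : 𝔼) :
    ∃ T ξ, 0 < T ∧ IsFlowSolution M x T ξ := by
  have h0 : (0 : 𝔼) ∈ chamber M x := fun w _ => by rw [inner_zero_left]; exact one_pos
  obtain ⟨α, ε, hε, hα, h⟩ := exists_integralCurve h0 (Submodule.zero_mem _) 0
  have hsub : ∀ t ∈ Set.Ico 0 ε, t ∈ Set.Ioo (0 - ε) (0 + ε) := fun t ht =>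
    ⟨by linarith [ht.1], by linarith [ht.2]⟩
  exact ⟨ε, α, hε, hα, fun t ht => (h t (hsub t ht)).1, fun t ht => (h t (hsub t ht)).2.1,
    fun t ht => (h t (hsub t ht)).2.2.hasDerivWithinAt⟩

/-- A solution with a limit in the chamber at the final time can be continued. -/
theorem IsFlowSolution.exists_extension {M : Set 𝔼} {x z : 𝔼} {T : ℝ} {ξ : ℝ → 𝔼}
    (h : IsFlowSolution M x T ξ) (hT : 0 < T) (hlim : Tendsto ξ (𝓝[<] T) (𝓝 z))
    (hz : z ∈ MCFIso.chamber M x) : ∃ T' ξ', T < T' ∧ IsFlowSolution M x T' ξ' := by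
  have hIco : Set.Ico 0 T ∈ 𝓝[<] T := Ico_mem_nhdsLT hT
  have hzn : z ∈ normalSpace M x :=
    (Submodule.closed_of_finiteDimensional (normalSpace M x)).mem_of_tendsto hlim
      (by filter_upwards [hIco] with t ht using h.normal t ht)
  obtain ⟨α, ε, hε, hα, hαd⟩ := exists_integralCurve hz hzn T
  set ζ : ℝ → 𝔼 := fun t => if t < T then ξ t else α t with hζ
  have hζl : ∀ t, t < T → ζ t = ξ t := fun t ht => if_pos ht
  have hζr : ∀ t, T ≤ t → ζ t = α t := fun t ht => if_neg (not_lt.2 ht)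
  have hIoo : ∀ t, T ≤ t → t < T + ε → t ∈ Set.Ioo (T - ε) (T + ε) := fun t h1 h2 =>
    ⟨by linarith, h2⟩
  have hleft : ∀ t ∈ Set.Ico 0 T,
      HasDerivWithinAt ζ (flowField M x (ζ t)) (Set.Ico 0 (T + ε)) t := by
    intro t ht
    rw [hζl t ht.2]
    have h1 := (h.hasDerivWithinAt ht).congr (f₁ := ζ) (fun s hs => hζl s hs.2) (hζl t ht.2)
    refine h1.mono_of_mem_nhdsWithin ?_
    filter_upwards [self_mem_nhdsWithin,
      mem_nhdsWithin_of_mem_nhds (Iio_mem_nhds ht.2)] with s h1 h2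
    exact ⟨h1.1, h2⟩
  refine ⟨T + ε, ζ, by linarith, ?_, fun t ht => ?_, fun t ht => ?_, fun t ht => ?_⟩
  · rw [hζl 0 hT, h.initial]
  · rcases lt_or_ge t T with hlt | hge
    · rw [hζl t hlt]; exact h.normal t ⟨ht.1, hlt⟩
    · rw [hζr t hge]; exact (hαd t (hIoo t hge ht.2)).1
  · rcases lt_or_ge t T with hlt | hge
    · rw [hζl t hlt]; exact h.chamber t ⟨ht.1, hlt⟩
    · rw [hζr t hge]; exact (hαd t (hIoo t hge ht.2)).2.1
  · change HasDerivWithinAt ζ (flowField M x (ζ t)) _ _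
    rcases lt_trichotomy t T with hlt | rfl | hgt
    · exact hleft t ⟨ht.1, hlt⟩
    · have hζt : ζ t = z := by rw [hζr t le_rfl, hα]
      rw [hζt]
      have hR : HasDerivWithinAt ζ (flowField M x z) (Set.Ici t) t := by
        have h1 := (hαd t (hIoo t le_rfl ht.2)).2.2.hasDerivWithinAt (s := Set.Ici t)
        rw [hα] at h1
        exact h1.congr (fun s hs => hζr s hs) (hζr t le_rfl)
      have hlimζ : Tendsto ζ (𝓝[<] t) (𝓝 z) := by
        refine hlim.congr' ?_
        filter_upwards [hIco] with s hs using (hζl s hs.2).symm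
      have hIoo' : Set.Ioo 0 t ∈ 𝓝[<] t := Ioo_mem_nhdsLT hT
      have hdIoo : ∀ s ∈ Set.Ioo 0 t, HasDerivAt ζ (flowField M x (ζ s)) s := fun s hs =>
        (hleft s ⟨hs.1.le, hs.2⟩).hasDerivAt (Ico_mem_nhds hs.1 (hs.2.trans ht.2))
      have hL : HasDerivWithinAt ζ (flowField M x z) (Set.Iic t) t := by
        refine hasDerivWithinAt_Iic_of_tendsto_deriv (s := Set.Ioo 0 t)
          (fun s hs => (hdIoo s hs).differentiableAt.differentiableWithinAt) ?_ hIoo' ?_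
        · change Tendsto ζ _ (𝓝 (ζ t))
          rw [hζt]
          exact hlimζ.mono_left (nhdsWithin_mono _ fun s hs => hs.2)
        · have h2 : Tendsto (fun s => flowField M x (ζ s)) (𝓝[<] t) (𝓝 (flowField M x z)) :=
            (((contDiffOn_flowField M x).continuousOn.continuousAt
              ((isOpen_chamber M x).mem_nhds hz)).tendsto).comp hlimζ
          refine h2.congr' ?_
          filter_upwards [hIoo'] with s hs using (hdIoo s hs).deriv.symm
      exact (hL.union hR).mono fun s _ => le_total s t
    · rw [hζr t hgt.le]
      refine HasDerivAt.hasDerivWithinAt ?_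
      refine (hαd t (hIoo t hgt.le ht.2)).2.2.congr_of_eventuallyEq ?_
      filter_upwards [Ioi_mem_nhds hgt] with s hs using hζr s (le_of_lt hs)

/-- If the existence times are bounded, there is a maximal solution. -/
theorem exists_maximal_isFlowSolution {M : Set 𝔼} {x : 𝔼} {B : ℝ}
    (hB : ∀ T ξ, IsFlowSolution M x T ξ → T ≤ B) :
    ∃ T ξ, 0 < T ∧ IsFlowSolution M x T ξ ∧
      ∀ T' ξ', IsFlowSolution M x T' ξ' → T' ≤ T ∧ Set.EqOn ξ' ξ (Set.Ico 0 T') := by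
  set S : Set ℝ := {T | ∃ ξ, IsFlowSolution M x T ξ} with hS
  have hbdd : BddAbove S := ⟨B, fun T ⟨ξ, h⟩ => hB T ξ h⟩
  obtain ⟨T₀, ξ₀, hT₀, h₀⟩ := exists_isFlowSolution M x
  have hne : S.Nonempty := ⟨T₀, ξ₀, h₀⟩
  set T := sSup S with hT
  have hTpos : 0 < T := hT₀.trans_le (le_csSup hbdd ⟨ξ₀, h₀⟩)
  have hex : ∀ t, t < T → ∃ ξ, IsFlowSolution M x ((t + T) / 2) ξ := by
    intro t ht
    obtain ⟨T₁, ⟨ξ₁, h₁⟩, hlt⟩ := exists_lt_of_lt_csSup hne (show (t + T) / 2 < T by linarith)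
    exact ⟨ξ₁, h₁.mono hlt.le⟩
  -- the maximal solution at time `t` is the value of a solution on `[0, (t + T) / 2)`
  choose! Ξ hΞ using hex
  have heq : ∀ T' ξ', IsFlowSolution M x T' ξ' → ∀ t ∈ Set.Ico 0 T, t < T' → Ξ t t = ξ' t :=
    fun T' ξ' h' t ht htT' => (hΞ t ht.2).eq h' ⟨ht.1, by linarith [ht.2]⟩ ⟨ht.1, htT'⟩
  refine ⟨T, fun t => Ξ t t, hTpos, ⟨(hΞ 0 hTpos).initial, fun t ht => ?_, fun t ht => ?_,
    fun t ht => ?_⟩, fun T' ξ' h' => ?_⟩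
  · exact (hΞ t ht.2).normal t ⟨ht.1, by linarith [ht.2]⟩
  · exact (hΞ t ht.2).chamber t ⟨ht.1, by linarith [ht.2]⟩
  · have h1 := (hΞ t ht.2).flow t ⟨ht.1, by linarith [ht.2]⟩
    have h2 := h1.congr (f₁ := fun t => Ξ t t) (fun s hs =>
      heq _ _ (hΞ t ht.2) s ⟨hs.1, by linarith [hs.2, ht.2]⟩ hs.2) rfl
    refine h2.mono_of_mem_nhdsWithin ?_
    filter_upwards [self_mem_nhdsWithin, mem_nhdsWithin_of_mem_nhds
      (Iio_mem_nhds (show t < (t + T) / 2 by linarith [ht.2]))] with s h1 h2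
    exact ⟨h1.1, h2⟩
  · have hle : T' ≤ T := le_csSup hbdd ⟨ξ', h'⟩
    exact ⟨hle, fun t ht => (heq T' ξ' h' t ⟨ht.1, ht.2.trans_le hle⟩ ht.2).symm⟩

/-! ### Mean curvature of parallel submanifolds -/

/-- For a submanifold of a sphere centred at the origin the position vector is a parallel normal
field. -/
theorem isParallelNormalField_id {M : Set 𝔼} {r₀ : ℝ}
    (hs : M ⊆ Metric.sphere 0 r₀) : IsParallelNormalField M (M ∩ Set.univ) fun y => y where
  smooth := contDiffOn_id
  normal := fun x hx => by
    rw [mem_normalSpace_iff]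
    intro u hu
    have h1 := (hasFDerivWithinAt_id x M).inner ℝ (hasFDerivWithinAt_id x M)
    have h2 := h1.sub_const (r₀ ^ 2)
    have h3 := fderivWithin_eq_zero_of_eventually hx.1 h2 (by
      filter_upwards [self_mem_nhdsWithin] with y hy
      have h4 : ‖y‖ = r₀ := by simpa using hs hy
      simp only [id, real_inner_self_eq_norm_sq, h4, sub_self]) hu
    simp only [fderivInnerCLM_apply, ContinuousLinearMap.comp_apply,
      ContinuousLinearMap.prod_apply, ContinuousLinearMap.id_apply, id] at h3
    have h4 := real_inner_comm x u
    linarith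
  parallel := fun x hx v hv => by
    have h : HasFDerivWithinAt (fun y : 𝔼 => y) (ContinuousLinearMap.id ℝ 𝔼) M x :=
      hasFDerivWithinAt_id x M
    have := fderiv_unique_on_tangentSpace h.differentiableWithinAt.hasFDerivWithinAt h hv
    rw [diff, this]
    exact hv

/-- The shape operator in the direction of the position vector is `-1`. -/
theorem inner_curvatureNormal {n : ℕ} {M : Set 𝔼} (hM : IsSubmanifold n M) {r₀ : ℝ}
    (hs : M ⊆ Metric.sphere 0 r₀) {x w : 𝔼} (hx : x ∈ M) (hw : w ∈ curvatureNormals M x) :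
    ⟪x, w⟫ = -1 := by
  have hid := isParallelNormalField_id hs
  have hxu : x ∈ M ∩ Set.univ := ⟨hx, trivial⟩
  obtain ⟨u, hu, hu0⟩ := Submodule.exists_mem_ne_zero_of_ne_bot (mem_curvatureNormals.1 hw).2
  have h1 := hid.diff_apply hM isOpen_univ hxu u
  have h : HasFDerivWithinAt (fun y : 𝔼 => y) (ContinuousLinearMap.id ℝ 𝔼) M x :=
    hasFDerivWithinAt_id x M
  have h2 : diff M (fun y => y) x u = u :=
    fderiv_unique_on_tangentSpace h.differentiableWithinAt.hasFDerivWithinAt h u.2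
  rw [h2, mem_curvatureSpace.1 hu x (hid.normal x hxu), Submodule.coe_smul] at h1
  have h3 : (1 + ⟪x, w⟫) • (u : 𝔼) = 0 := by
    rw [add_smul, one_smul]
    nth_rw 1 [h1]
    rw [neg_add_cancel]
  have h4 : (u : 𝔼) ≠ 0 := fun hc => hu0 (Subtype.ext hc)
  have h5 := (smul_eq_zero.1 h3).resolve_right h4
  linarith

/-- The relation `⟪x(t), H(t)⟫ = -n`: each principal direction contributes `-1`, since
`⟪x + z, nᵢ⟫ = -(1 - ⟪z, nᵢ⟫)`. -/
theorem inner_flowField {n : ℕ} {M : Set 𝔼} (hM : IsIsoparametric n M) {r₀ : ℝ}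
    (hs : M ⊆ Metric.sphere 0 r₀) {x z : 𝔼} (hx : x ∈ M) (hz : z ∈ chamber M x) :
    ⟪x + z, flowField M x z⟫ = -(n : ℝ) := by
  obtain ⟨b, ν, hν⟩ := hM.exists_isPrincipalFrame hx
  rw [hν.flowField_eq hM.submanifold hx, inner_sum]
  have : ∀ i, ⟪x + z, (1 - ⟪z, ν i⟫)⁻¹ • ν i⟫ = -1 := by
    intro i
    have hi : ν i ∈ curvatureNormals M x :=
      (hν.mem_curvatureNormals_iff hM.submanifold hx).2 ⟨i, rfl⟩
    have h1 := hz _ hi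
    rw [inner_smul_right, inner_add_left, inner_curvatureNormal hM.submanifold hs hx hi]
    have h2 : (1 - ⟪z, ν i⟫) ≠ 0 := by linarith
    field_simp
    ring
  rw [Finset.sum_congr rfl fun i _ => this i]
  simp

/-- Along the flow the squared norm decreases at the constant rate `2n`. -/
theorem IsFlowSolution.norm_sq {n : ℕ} {M : Set 𝔼} (hM : IsIsoparametric n M) {r₀ : ℝ}
    (hs : M ⊆ Metric.sphere 0 r₀) {x : 𝔼} (hx : x ∈ M) {T : ℝ} {ξ : ℝ → 𝔼}
    (h : IsFlowSolution M x T ξ) {t : ℝ} (ht : t ∈ Set.Ico 0 T) :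
    ‖x + ξ t‖ ^ 2 = ‖x + ξ 0‖ ^ 2 - 2 * n * t := by
  have hsub : Set.Icc 0 t ⊆ Set.Ico 0 T := fun s hs => ⟨hs.1, hs.2.trans_lt ht.2⟩
  have hd : ∀ s ∈ Set.Ico 0 T,
      HasDerivWithinAt (fun s => ‖x + ξ s‖ ^ 2 + 2 * n * s) 0 (Set.Ico 0 T) s := by
    intro s hs'
    have h1 := ((h.hasDerivWithinAt hs').const_add x).norm_sq
    rw [inner_flowField hM hs hx (h.chamber s hs')] at h1
    have h2 := h1.add ((hasDerivWithinAt_id s (Set.Ico 0 T)).const_mul (2 * (n : ℝ)))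
    refine h2.congr_deriv ?_
    ring
  have := constant_of_has_deriv_right_zero (a := 0) (b := t)
    (fun s hs' => ((hd s (hsub hs')).continuousWithinAt).mono hsub)
    (fun s hs' => hasDerivWithinAt_Ici_of_Ico (hsub (Set.Ico_subset_Icc_self hs'))
      (hd s (hsub (Set.Ico_subset_Icc_self hs')))) t ⟨ht.1, le_rfl⟩
  simp only [mul_zero, add_zero] at this
  linarith

theorem IsFlowSolution.le_time {n : ℕ} (hn : 1 ≤ n) {M : Set 𝔼} (hM : IsIsoparametric n M) {r₀ : ℝ}
    (hs : M ⊆ Metric.sphere 0 r₀) {x : 𝔼} (hx : x ∈ M) {T : ℝ} {ξ : ℝ → 𝔼}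
    (h : IsFlowSolution M x T ξ) : T ≤ r₀ ^ 2 / (2 * n) := by
  have hn' : (0 : ℝ) < n := by exact_mod_cast hn
  have hx0 : ‖x‖ = r₀ := by simpa using hs hx
  refine le_of_forall_lt fun t ht => ?_
  by_contra hc
  push Not at hc
  have ht0 : 0 ≤ t := (by positivity : 0 ≤ r₀ ^ 2 / (2 * (n : ℝ))).trans hc
  obtain ⟨s, hts, hsT⟩ := exists_between ht
  have h1 := h.norm_sq hM hs hx ⟨ht0.trans hts.le, hsT⟩
  rw [h.initial, add_zero, hx0] at h1
  have h2 : r₀ ^ 2 / (2 * n) < s := hc.trans_lt hts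
  rw [div_lt_iff₀ (by positivity)] at h2
  have h3 := sq_nonneg ‖x + ξ s‖
  linarith

/-- The differential of the parallel map `y ↦ y + η y` is `1 - A_η`. -/
theorem diff_add_apply {n : ℕ} {M : Set 𝔼} (hM : IsSubmanifold n M) {η : 𝔼 → 𝔼}
    (hη : IsParallelNormalField M (M ∩ Set.univ) η) {x : 𝔼} (hx : x ∈ M) (u : tangentSpace M x) :
    diff M (fun y => y + η y) x u = (u - shapeOperator M x (η x) u : tangentSpace M x) := by
  have hxu : x ∈ M ∩ Set.univ := ⟨hx, trivial⟩
  have h : HasFDerivWithinAt (fun y => y + η y) (ContinuousLinearMap.id ℝ 𝔼 + diff M η x) M x :=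
    (hasFDerivWithinAt_id x M).add (hη.hasFDerivWithinAt isOpen_univ hxu)
  rw [diff, fderiv_unique_on_tangentSpace h.differentiableWithinAt.hasFDerivWithinAt h u.2,
    add_apply, hη.diff_apply hM isOpen_univ hxu]
  simp [sub_eq_add_neg]

theorem isImmersionOn_add {n : ℕ} {M : Set 𝔼} (hM : IsSubmanifold n M) {η : 𝔼 → 𝔼}
    (hη : IsParallelNormalField M (M ∩ Set.univ) η)
    (h1 : ∀ x ∈ M, (shapeOperator M x (η x)).eigenspace 1 = ⊥) :
    IsImmersionOn M fun y => y + η y := by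
  refine ⟨contDiffOn_id.add (by simpa using hη.smooth), fun x hx v hv h0 => ?_⟩
  have h2 := diff_add_apply hM hη hx ⟨v, hv⟩
  rw [h0] at h2
  have h3 : (⟨v, hv⟩ : tangentSpace M x) - shapeOperator M x (η x) ⟨v, hv⟩ = 0 :=
    Subtype.ext h2.symm
  have h4 : (⟨v, hv⟩ : tangentSpace M x) ∈ (shapeOperator M x (η x)).eigenspace 1 := by
    rw [Module.End.mem_eigenspace_iff, one_smul]
    exact (sub_eq_zero.1 h3).symm
  rw [h1 x hx, Submodule.mem_bot] at h4
  exact congrArg Subtype.val h4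

/-- The focal set: `1` is an eigenvalue of `A_v` exactly if `⟪v, nᵢ⟫ = 1` for some curvature
normal. -/
theorem eigenspace_one_eq_bot_iff {n : ℕ} {M : Set 𝔼} (hM : IsIsoparametric n M) {x v : 𝔼}
    (hx : x ∈ M) (hv : v ∈ normalSpace M x) :
    (shapeOperator M x v).eigenspace 1 = ⊥ ↔ ∀ w ∈ curvatureNormals M x, ⟪v, w⟫ ≠ 1 := by
  obtain ⟨b, ν, hν⟩ := hM.exists_isPrincipalFrame hx
  rw [← Submodule.finrank_eq_zero (R := ℝ), hν.finrank_eigenspace hM.submanifold hx hv,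
    Finset.card_eq_zero, Finset.filter_eq_empty_iff]
  constructor
  · intro h w hw
    obtain ⟨i, rfl⟩ := (hν.mem_curvatureNormals_iff hM.submanifold hx).1 hw
    exact h (Finset.mem_univ i)
  · intro h i _
    exact h _ ((hν.mem_curvatureNormals_iff hM.submanifold hx).2 ⟨i, rfl⟩)

/-- The trace of a bilinear form with respect to the metric `⟪S u, S w⟫`, where `S` is
diagonalized by the orthonormal basis `c`: it may be computed in any orthonormal basis `b`. -/
theorem sum_inv_gram_mul {V ι κ : Type*} [NormedAddCommGroup V] [InnerProductSpace ℝ V]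
    [Fintype ι] [DecidableEq ι] [Fintype κ] [DecidableEq κ] (b : OrthonormalBasis ι ℝ V)
    (c : OrthonormalBasis κ ℝ V)
    (S : V →ₗ[ℝ] V) (s : κ → ℝ) (hS : ∀ k, S (c k) = s k • c k) (hs : ∀ k, s k ≠ 0)
    (B : V →ₗ[ℝ] V →ₗ[ℝ] ℝ) :
    ∑ i, ∑ j, ((Matrix.of fun i j => ⟪S (b i), S (b j)⟫)⁻¹ : Matrix ι ι ℝ) i j * B (b i) (b j) =
      ∑ k, (s k ^ 2)⁻¹ * B (c k) (c k) := by
  let U : Matrix ι κ ℝ := Matrix.of fun i k => ⟪b i, c k⟫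
  have hUU : U * U.transpose = 1 := by
    ext i j
    rw [Matrix.mul_apply]
    have h := c.sum_inner_mul_inner (b i) (b j)
    simp only [U, Matrix.transpose_apply, Matrix.of_apply, Matrix.one_apply]
    rw [← orthonormal_iff_ite.1 b.orthonormal i j, ← h]
    exact Finset.sum_congr rfl fun k _ => by rw [real_inner_comm (b j)]
  have hUU' : U.transpose * U = 1 := by
    ext i j
    rw [Matrix.mul_apply]
    have h := b.sum_inner_mul_inner (c i) (c j)
    simp only [U, Matrix.transpose_apply, Matrix.of_apply, Matrix.one_apply]
    rw [← orthonormal_iff_ite.1 c.orthonormal i j, ← h]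
    exact Finset.sum_congr rfl fun k _ => by rw [real_inner_comm (c i)]
  have hSc : ∀ v k, ⟪S v, c k⟫ = s k * ⟪v, c k⟫ := by
    intro v k
    conv_lhs => rw [← c.sum_repr' v, map_sum]
    simp only [map_smul, hS, sum_inner, real_inner_smul_left, orthonormal_iff_ite.1 c.orthonormal]
    simp [real_inner_comm v, mul_comm]
  have hG : (Matrix.of fun i j => ⟪S (b i), S (b j)⟫ : Matrix ι ι ℝ) =
      U * Matrix.diagonal (fun k => s k ^ 2) * U.transpose := by
    ext i j
    rw [Matrix.mul_apply]
    simp only [Matrix.of_apply, Matrix.mul_diagonal, Matrix.transpose_apply, U]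
    rw [← c.sum_inner_mul_inner]
    refine Finset.sum_congr rfl fun k _ => ?_
    rw [hSc, real_inner_comm (S (b j)) (c k), hSc]
    ring
  have hinv : (Matrix.of fun i j => ⟪S (b i), S (b j)⟫ : Matrix ι ι ℝ)⁻¹ =
      U * Matrix.diagonal (fun k => (s k ^ 2)⁻¹) * U.transpose := by
    refine Matrix.inv_eq_right_inv ?_
    have hdd : Matrix.diagonal (fun k => s k ^ 2) * Matrix.diagonal (fun k => (s k ^ 2)⁻¹) =
        (1 : Matrix κ κ ℝ) := by
      rw [Matrix.diagonal_mul_diagonal, ← Matrix.diagonal_one]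
      congr 1
      ext k
      exact mul_inv_cancel₀ (pow_ne_zero 2 (hs k))
    calc _ = U * Matrix.diagonal (fun k => s k ^ 2) * (U.transpose * U) *
          Matrix.diagonal (fun k => (s k ^ 2)⁻¹) * U.transpose := by
            rw [hG]; simp only [Matrix.mul_assoc]
      _ = 1 := by
        rw [hUU', Matrix.mul_one, Matrix.mul_assoc U, hdd, Matrix.mul_one, hUU]
  have hB : ∀ k, B (c k) (c k) = ∑ i, ∑ j, ⟪b i, c k⟫ * ⟪b j, c k⟫ * B (b i) (b j) := by
    intro k
    conv_lhs => rw [← b.sum_repr' (c k)]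
    simp only [map_sum, map_smul, LinearMap.sum_apply, LinearMap.smul_apply, smul_eq_mul,
      Finset.mul_sum, mul_assoc]
    rw [Finset.sum_comm]
    refine Finset.sum_congr rfl fun i _ => Finset.sum_congr rfl fun j _ => ?_
    ring
  have hij : ∀ i j, (U * Matrix.diagonal (fun k => (s k ^ 2)⁻¹) * U.transpose) i j =
      ∑ k, ⟪b i, c k⟫ * (s k ^ 2)⁻¹ * ⟪b j, c k⟫ := by
    intro i j
    rw [Matrix.mul_apply]
    simp only [Matrix.mul_diagonal, Matrix.transpose_apply, Matrix.of_apply, U]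
  rw [hinv]
  simp only [hB, hij, Finset.mul_sum, Finset.sum_mul]
  rw [Finset.sum_comm (s := (Finset.univ : Finset κ))]
  refine Finset.sum_congr rfl fun i _ => ?_
  rw [Finset.sum_comm (s := (Finset.univ : Finset κ))]
  refine Finset.sum_congr rfl fun j _ => Finset.sum_congr rfl fun k _ => ?_
  ring

theorem starProjection_orthogonal_congr {K K' : Submodule ℝ 𝔼} (h : K = K') (v : 𝔼) :
    Kᗮ.starProjection v = K'ᗮ.starProjection v := by
  subst h; rfl

/-- The differential of a smooth map, applied to the tangential part of a constant vector, is a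
differentiable field along `M`. -/
theorem differentiableWithinAt_diff_starProjection {n : ℕ} {M : Set 𝔼} (hM : IsSubmanifold n M)
    {f : 𝔼 → 𝔼} (hf : ContDiffOn ℝ ∞ f M) {x : 𝔼} (hx : x ∈ M) (w : 𝔼) :
    HasFDerivWithinAt (fun y => diff M f y ((tangentSpace M y).starProjection w))
      (diff M (fun y => diff M f y ((tangentSpace M y).starProjection w)) x) M x := by
  obtain ⟨O, π, R, hxO, -⟩ := hM.exists_isRetraction hx
  obtain ⟨P, hP, hPM⟩ := R.exists_contDiffOn_starProjection
  have hfO := hf.mono (Set.inter_subset_left (t := O))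
  have hF : ContDiffOn ℝ ∞ (fderiv ℝ fun y => f (π y)) O :=
    (R.contDiffOn_comp hfO).fderiv_of_isOpen R.isOpen (by simp)
  have h1 : DifferentiableAt ℝ (fun y => fderiv ℝ (fun y => f (π y)) y (P y w)) x :=
    ((hF.contDiffAt (R.mem_nhds hxO)).differentiableAt (by simp)).clm_apply
      (((hP.contDiffAt (R.mem_nhds hxO)).differentiableAt (by simp)).clm_apply
        (differentiableAt_const w))
  refine (h1.differentiableWithinAt.congr_of_eventuallyEq_of_mem ?_ hx).hasFDerivWithinAt
  filter_upwards [R.eventually_mem hxO] with y hy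
  rw [hPM y hy, R.diff_eq hfO hy (Submodule.starProjection_apply_mem _ _)]

/-- The mean curvature vector of the parallel map `y ↦ y + η y`. -/
theorem meanCurvatureVector_add {n : ℕ} {M : Set 𝔼} (hM : IsIsoparametric n M) {η : 𝔼 → 𝔼}
    (hη : IsParallelNormalField M M η) {x : 𝔼} (hx : x ∈ M)
    (h1 : ∀ w ∈ curvatureNormals M x, ⟪η x, w⟫ ≠ 1) :
    meanCurvatureVector M (fun y => y + η y) x = flowField M x (η x) := by
  classical
  replace hη : IsParallelNormalField M (M ∩ Set.univ) η := by simpa using hη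
  have hxu : x ∈ M ∩ Set.univ := ⟨hx, trivial⟩
  set f : 𝔼 → 𝔼 := fun y => y + η y with hf
  have hfs : ContDiffOn ℝ ∞ f M := contDiffOn_id.add (by simpa using hη.smooth)
  obtain ⟨O, π, R, hxO, -⟩ := hM.submanifold.exists_isRetraction hx
  obtain ⟨c, ν, hν⟩ := hM.exists_isPrincipalFrame hx
  have hs : ∀ k, 1 - ⟪η x, ν k⟫ ≠ 0 := fun k hk =>
    h1 (ν k) ((hν.mem_curvatureNormals_iff hM.submanifold hx).2 ⟨k, rfl⟩) (by linarith)
  let S : tangentSpace M x →ₗ[ℝ] tangentSpace M x := LinearMap.id - shapeOperator M x (η x)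
  have hSc : ∀ k, S (c k) = (1 - ⟪η x, ν k⟫) • c k := fun k => by
    rw [sub_smul, one_smul, ← hν.apply _ (hη.normal x hxu)]; rfl
  have hdf : ∀ y ∈ M, ∀ u : tangentSpace M y,
      diff M f y u = (u - shapeOperator M y (η y) u : tangentSpace M y) :=
    fun y hy u => diff_add_apply hM.submanifold hη hy u
  have hdS : ∀ u : tangentSpace M x, diff M f x u = S u := fun u => hdf x hx u
  have hmap : (tangentSpace M x).map (diff M f x).toLinearMap = tangentSpace M x := by
    have hle : ∀ u : tangentSpace M x, ∃ v, S v = u := by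
      intro u
      refine ⟨∑ k, ((1 - ⟪η x, ν k⟫)⁻¹ * ⟪c k, u⟫) • c k, ?_⟩
      simp only [map_sum, map_smul, hSc, smul_smul]
      conv_rhs => rw [← c.sum_repr' u]
      refine Finset.sum_congr rfl fun k _ => ?_
      congr 1
      field_simp [hs k]
    ext v
    constructor
    · rintro ⟨u, hu, rfl⟩
      exact (hdS ⟨u, hu⟩) ▸ (S ⟨u, hu⟩).2
    · intro hv
      obtain ⟨u, hu⟩ := hle ⟨v, hv⟩
      exact ⟨u, u.2, (hdS u).trans (congrArg Subtype.val hu)⟩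
  have hII : ∀ v ∈ normalSpace M x, ∀ u w : tangentSpace M x,
      ⟪v, secondFundamentalForm M f x u w⟫ = ⟪shapeOperator M x v u, S w⟫ := by
    intro v hv u w
    rw [secondFundamentalForm, starProjection_orthogonal_congr hmap]
    change ⟪v, (normalSpace M x).starProjection _⟫ = _
    rw [← Submodule.inner_starProjection_left_eq_right,
      Submodule.starProjection_eq_self_iff.2 hv,
      R.inner_deriv_tangentField hxO
        (differentiableWithinAt_diff_starProjection hM.submanifold hfs hx w) ?_ u.2 hv,
      Submodule.starProjection_eq_self_iff.2 w.2, hdS, R.inner_shapeOperator hxO hv]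
    filter_upwards [self_mem_nhdsWithin] with y hy
    have := hdf y hy ⟨_, Submodule.starProjection_apply_mem (tangentSpace M y) (w : 𝔼)⟩
    exact this ▸ Submodule.coe_mem _
  have hnormal : meanCurvatureVector M f x ∈ normalSpace M x := by
    refine Submodule.sum_mem _ fun i _ => Submodule.sum_mem _ fun j _ => Submodule.smul_mem _ _ ?_
    rw [secondFundamentalForm, starProjection_orthogonal_congr hmap]
    exact Submodule.starProjection_apply_mem _ _
  have hinner : ∀ v ∈ normalSpace M x,
      ⟪v, meanCurvatureVector M f x⟫ = ⟪v, flowField M x (η x)⟫ := by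
    intro v hv
    let B : tangentSpace M x →ₗ[ℝ] tangentSpace M x →ₗ[ℝ] ℝ :=
      (innerₗ (tangentSpace M x)).compl₁₂ (shapeOperator M x v) S
    have hB : ∀ u w, B u w = ⟪shapeOperator M x v u, S w⟫ := fun u w => rfl
    have hG : inducedMetric M f x = Matrix.of fun i j =>
        ⟪S (stdOrthonormalBasis ℝ (tangentSpace M x) i),
          S (stdOrthonormalBasis ℝ (tangentSpace M x) j)⟫ := by
      ext i j
      rw [inducedMetric, Matrix.of_apply, Matrix.of_apply, hdS, hdS, Submodule.coe_inner]
    rw [meanCurvatureVector, hG, hν.flowField_eq hM.submanifold hx]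
    simp only [inner_sum, inner_smul_right, hII v hv, ← hB]
    rw [sum_inv_gram_mul _ c S (fun k => 1 - ⟪η x, ν k⟫) hSc hs B]
    refine Finset.sum_congr rfl fun k _ => ?_
    have hAc : ⟪shapeOperator M x v (c k), S (c k)⟫ = ⟪v, ν k⟫ * (1 - ⟪η x, ν k⟫) := by
      rw [hSc, hν.apply v hv]
      have h2 : ⟪c k, c k⟫ = 1 := by
        rw [real_inner_self_eq_norm_sq, c.orthonormal.1 k, one_pow]
      calc _ = ⟪v, ν k⟫ * ((1 - ⟪η x, ν k⟫) * ⟪c k, c k⟫) := by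
            rw [← real_inner_smul_right, ← real_inner_smul_left]
        _ = _ := by rw [h2, mul_one]
    rw [hB, hAc]
    field_simp [hs k]
  have hd := Submodule.sub_mem _ hnormal (flowField_mem M x (η x))
  refine sub_eq_zero.1 (inner_self_eq_zero (𝕜 := ℝ).1 ?_)
  rw [inner_sub_right, hinner _ hd, sub_self]

/-! ### The maximum principle -/

/-- The second derivative is negative semidefinite at a local maximum. -/
theorem fderiv_fderiv_nonpos_of_isLocalMax {k : 𝔼 → ℝ} {p : 𝔼} (hk : ContDiffAt ℝ ∞ k p)
    (hmax : IsLocalMax k p) (u : 𝔼) : fderiv ℝ (fderiv ℝ k) p u u ≤ 0 := by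
  set γ : ℝ → 𝔼 := fun s => p + s • u with hγ
  have hγ0 : γ 0 = p := by simp [hγ]
  have hγd : ∀ s, HasDerivAt γ u s := fun s => by
    have h := ((hasDerivAt_id s).smul_const u).const_add p
    rw [one_smul] at h
    exact h
  have hγt : Tendsto γ (𝓝 0) (𝓝 p) := by
    have := (hγd 0).continuousAt.tendsto
    rwa [hγ0] at this
  have hev : ∀ᶠ y in 𝓝 p, ContDiffAt ℝ 1 k y :=
    (hk.of_le (by simp : (1 : ℕ∞ω) ≤ ∞)).eventually (by simp)
  have hd1 : deriv (k ∘ γ) =ᶠ[𝓝 0] fun s => fderiv ℝ k (γ s) u := by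
    filter_upwards [hγt.eventually hev] with s hs
    exact ((hs.differentiableAt (by simp)).hasFDerivAt.comp_hasDerivAt s (hγd s)).deriv
  have hk2 : HasFDerivAt (fderiv ℝ k) (fderiv ℝ (fderiv ℝ k) p) (γ 0) := by
    rw [hγ0]
    exact ((hk.fderiv_right (m := 1) (by exact two_le_infty)).differentiableAt
      (by simp)).hasFDerivAt
  have hd2 : deriv (deriv (k ∘ γ)) 0 = fderiv ℝ (fderiv ℝ k) p u u := by
    rw [hd1.deriv_eq]
    have h1 := (hk2.comp_hasDerivAt (0 : ℝ) (hγd 0)).clm_apply (hasDerivAt_const (0 : ℝ) u)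
    simpa using h1.deriv
  have hmax' : IsLocalMax (k ∘ γ) 0 := by
    have h1 : ∀ᶠ y in 𝓝 p, k y ≤ k p := hmax
    filter_upwards [hγt.eventually h1] with s hs
    simpa only [Function.comp, hγ0] using hs
  by_contra hpos
  push Not at hpos
  -- otherwise `k` would be locally constant along the line
  have hmin : IsLocalMin (k ∘ γ) 0 := by
    refine isLocalMin_of_deriv_deriv_pos (by rw [hd2]; exact hpos) hmax'.deriv_eq_zero ?_
    refine ContinuousAt.comp ?_ (hγd 0).continuousAt
    rw [hγ0]
    exact hk.continuousAt
  have hconst : k ∘ γ =ᶠ[𝓝 0] fun _ => (k ∘ γ) 0 := by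
    filter_upwards [hmax', hmin] with s h1 h2 using le_antisymm h1 h2
  have h3 : deriv (k ∘ γ) =ᶠ[𝓝 0] fun _ => 0 := by
    filter_upwards [hconst.eventuallyEq_nhds] with s hs
    rw [hs.deriv_eq, deriv_const]
  rw [← hd2, h3.deriv_eq, deriv_const] at hpos
  exact lt_irrefl _ hpos

/-- At a point where an immersion of an `n`-dimensional manifold is farthest from the origin, its
mean curvature vector satisfies `⟪f, H⟫ ≤ -n`. -/
theorem IsImmersionOn.inner_meanCurvatureVector_le {n : ℕ} {M : Set 𝔼} (hM : IsSubmanifold n M)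
    {f : 𝔼 → 𝔼} (hf : IsImmersionOn M f) {p : 𝔼} (hp : p ∈ M) (hmax : ∀ y ∈ M, ‖f y‖ ≤ ‖f p‖) :
    ⟪f p, meanCurvatureVector M f p⟫ ≤ -(n : ℝ) := by
  classical
  obtain ⟨O, π, R, hpO, -⟩ := hM.exists_isRetraction hp
  obtain ⟨P, hP, hPM⟩ := R.exists_contDiffOn_starProjection
  have hfO := hf.1.mono (Set.inter_subset_left (t := O))
  set F : 𝔼 → 𝔼 := fun y => f (π y) with hF
  have hFs : ContDiffOn ℝ ∞ F O := R.contDiffOn_comp hfO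
  have hFp : F p = f p := by rw [hF]; simp only [R.fix p hpO]
  set k : 𝔼 → ℝ := fun y => 2⁻¹ * ⟪F y, F y⟫ with hk
  have hks : ContDiffOn ℝ ∞ k O := contDiffOn_const.mul (hFs.inner ℝ hFs)
  have hkp : ContDiffAt ℝ ∞ k p := hks.contDiffAt (R.mem_nhds hpO)
  have hFd : ∀ y ∈ O, HasFDerivAt F (fderiv ℝ F y) y := fun y hy => R.hasFDerivAt_comp hfO hy
  have hkd : ∀ y ∈ O, ∀ v, fderiv ℝ k y v = ⟪F y, fderiv ℝ F y v⟫ := by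
    intro y hy v
    have h1 := ((hFd y hy).inner ℝ (hFd y hy)).const_mul (2⁻¹ : ℝ)
    rw [h1.fderiv]
    simp only [smul_apply, fderivInnerCLM_apply,
      ContinuousLinearMap.comp_apply, ContinuousLinearMap.prod_apply, smul_eq_mul]
    rw [real_inner_comm (F y)]
    ring
  have hlocmax : IsLocalMax k p := by
    filter_upwards [R.mem_nhds hpO] with y hy
    simp only [hk, real_inner_self_eq_norm_sq, hFp]
    have := hmax _ (R.mapsTo y hy).1
    gcongr
  have hk0 : fderiv ℝ k p = 0 := hlocmax.fderiv_eq_zero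
  set T := tangentSpace M p
  have hdf : ∀ u ∈ T, diff M f p u = fderiv ℝ F p u := fun u hu => R.diff_eq hfO hpO hu
  -- `f p` is normal to the immersed tangent space
  have hnormal : f p ∈ (T.map (diff M f p).toLinearMap)ᗮ := by
    rw [Submodule.mem_orthogonal']
    rintro _ ⟨u, hu, rfl⟩
    change ⟪f p, diff M f p u⟫ = 0
    rw [hdf u hu, ← hFp, ← hkd p hpO.2, hk0]
    rfl
  -- differentiate `dk(w) = ⟪f, df(w)⟫` in the direction `u`, where `k = |f|²/2`
  have hII : ∀ u ∈ T, ∀ w ∈ T, ⟪f p, secondFundamentalForm M f p u w⟫ =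
      fderiv ℝ (fderiv ℝ k) p u w - ⟪diff M f p u, diff M f p w⟫ := by
    intro u hu w hw
    rw [secondFundamentalForm, ← Submodule.inner_starProjection_left_eq_right,
      Submodule.starProjection_eq_self_iff.2 hnormal]
    have hY := differentiableWithinAt_diff_starProjection hM hf.1 hp w
    have hfd : HasFDerivWithinAt f (diff M f p) M p :=
      ((hf.1 p hp).differentiableWithinAt (by simp)).hasFDerivWithinAt
    have h1 := hfd.inner ℝ hY
    have h2 : HasFDerivAt (fun y => fderiv ℝ k y (P y w)) _ p :=
      (((hks.fderiv_of_isOpen R.isOpen (by simp) :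
          ContDiffOn ℝ ∞ (fderiv ℝ k) O).contDiffAt (R.mem_nhds hpO)).differentiableAt
          (by simp)).hasFDerivAt.clm_apply
        (((hP.contDiffAt (R.mem_nhds hpO)).differentiableAt (by simp)).hasFDerivAt.clm_apply
          (hasFDerivAt_const w p))
    have h3 := h2.hasFDerivWithinAt (s := M)
    have h4 := fderivWithin_eq_zero_of_eventually hp (h3.sub h1) (by
      filter_upwards [R.eventually_mem hpO] with y hy
      have hPy : P y w ∈ tangentSpace M y := by
        rw [hPM y hy]; exact Submodule.starProjection_apply_mem _ _
      simp only [Pi.sub_apply]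
      rw [hkd y hy.2, ← hPM y hy, R.diff_eq hfO hy hPy]
      simp only [hF, R.fix y hy, sub_self]) hu
    have hPw : P p w = w := by
      rw [hPM p hpO]; exact Submodule.starProjection_eq_self_iff.2 hw
    have hPw' : (tangentSpace M p).starProjection w = w :=
      Submodule.starProjection_eq_self_iff.2 hw
    simp only [sub_apply, add_apply, fderivInnerCLM_apply, ContinuousLinearMap.comp_apply,
      ContinuousLinearMap.prod_apply, ContinuousLinearMap.flip_apply, hk0, hPw, hPw',
      zero_apply] at h4
    linarith
  set b := stdOrthonormalBasis ℝ T with hb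
  have hG : inducedMetric M f p = Matrix.gram ℝ fun i => diff M f p (b i) := rfl
  have hli : LinearIndependent ℝ fun i => diff M f p (b i) := by
    have hinj : Function.Injective ((diff M f p).toLinearMap ∘ₗ T.subtype) := by
      rw [injective_iff_map_eq_zero]
      intro v hv
      exact Subtype.ext (hf.2 p hp v v.2 hv)
    have h1 := b.toBasis.linearIndependent.map' _ (LinearMap.ker_eq_bot.2 hinj)
    simpa [Function.comp_def] using h1
  have hpos : (inducedMetric M f p).PosDef := hG ▸ Matrix.posDef_gram_of_linearIndependent hli
  set g := inducedMetric M f p with hg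
  have hsymm : ∀ i j, g i j = g j i := fun i j => by
    rw [hG, Matrix.gram_apply, Matrix.gram_apply, real_inner_comm]
  have htr : ∑ i, ∑ j, g⁻¹ i j * g i j = n := by
    have h1 : ∀ i, ∑ j, g⁻¹ i j * g i j = (g⁻¹ * g) i i := fun i => by
      rw [Matrix.mul_apply]
      exact Finset.sum_congr rfl fun j _ => by rw [hsymm i j]
    have h2 : IsUnit g.det := (Matrix.isUnit_iff_isUnit_det g).1 hpos.isUnit
    simp only [h1, Matrix.nonsing_inv_mul g h2, Matrix.one_apply_eq]
    simp only [Finset.sum_const, Finset.card_univ, Fintype.card_fin, nsmul_eq_mul, mul_one]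
    exact_mod_cast hM.finrank_tangentSpace hp
  -- the trace of the negative semidefinite Hessian against the positive definite `g⁻¹`
  have hle : ∑ i, ∑ j, g⁻¹ i j * fderiv ℝ (fderiv ℝ k) p (b i) (b j) ≤ 0 := by
    obtain ⟨m, v, hv⟩ := Matrix.posSemidef_iff_eq_sum_vecMulVec.1 hpos.inv.posSemidef
    have h1 : ∀ i j, g⁻¹ i j = ∑ l, v l i * v l j := fun i j => by
      rw [hv, Matrix.sum_apply]
      rfl
    have h2 : ∑ i, ∑ j, g⁻¹ i j * fderiv ℝ (fderiv ℝ k) p (b i) (b j) =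
        ∑ l, fderiv ℝ (fderiv ℝ k) p (∑ i, v l i • (b i : 𝔼)) (∑ i, v l i • (b i : 𝔼)) := by
      have h3 : ∀ l, fderiv ℝ (fderiv ℝ k) p (∑ i, v l i • (b i : 𝔼)) (∑ i, v l i • (b i : 𝔼)) =
          ∑ i, ∑ j, v l i * v l j * fderiv ℝ (fderiv ℝ k) p (b i) (b j) := by
        intro l
        rw [map_sum (fderiv ℝ (fderiv ℝ k) p), sum_apply]
        refine Finset.sum_congr rfl fun i _ => ?_
        rw [map_smul, smul_apply, map_sum, smul_eq_mul, Finset.mul_sum]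
        refine Finset.sum_congr rfl fun j _ => ?_
        rw [map_smul, smul_eq_mul, mul_assoc]
      simp only [h1, h3, Finset.sum_mul]
      rw [Finset.sum_comm (s := (Finset.univ : Finset (Fin m)))]
      refine Finset.sum_congr rfl fun i _ => ?_
      rw [Finset.sum_comm (s := (Finset.univ : Finset (Fin m)))]
    rw [h2]
    exact Finset.sum_nonpos fun l _ => fderiv_fderiv_nonpos_of_isLocalMax hkp hlocmax _
  have hexp : ⟪f p, meanCurvatureVector M f p⟫ =
      ∑ i, ∑ j, g⁻¹ i j * fderiv ℝ (fderiv ℝ k) p (b i) (b j) - ∑ i, ∑ j, g⁻¹ i j * g i j := by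
    rw [meanCurvatureVector]
    simp only [inner_sum, inner_smul_right]
    rw [← Finset.sum_sub_distrib]
    refine Finset.sum_congr rfl fun i _ => ?_
    rw [← Finset.sum_sub_distrib]
    refine Finset.sum_congr rfl fun j _ => ?_
    rw [hII _ (b i).2 _ (b j).2, mul_sub]
    rfl
  rw [hexp, htr]
  linarith

/-- Maximum principle: a mean curvature flow starting in a sphere stays inside the shrinking
balls of squared radius `r₀² - 2nt`. -/
theorem IsMeanCurvatureFlow.norm_sq_le {n : ℕ} {M : Set 𝔼} (hM : IsSubmanifold n M)
    (hc : IsCompact M) {r₀ : ℝ} (hs : M ⊆ Metric.sphere 0 r₀) {T : ℝ} {f : ℝ → 𝔼 → 𝔼}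
    (hf : IsMeanCurvatureFlow M T f) {t : ℝ} (ht : t ∈ Set.Ico 0 T) {x : 𝔼} (hx : x ∈ M) :
    ‖f t x‖ ^ 2 ≤ r₀ ^ 2 - 2 * n * t := by
  -- the term `-ε t` makes the time derivative at a maximum strictly negative
  have key : ∀ ε > 0, ‖f t x‖ ^ 2 + (2 * n - ε) * t ≤ r₀ ^ 2 := by
    intro ε hε
    have hsub : Set.Icc 0 t ⊆ Set.Ico 0 T := fun s hs => ⟨hs.1, hs.2.trans_lt ht.2⟩
    have hcont : ContinuousOn (fun q : ℝ × 𝔼 => ‖f q.1 q.2‖ ^ 2 + (2 * n - ε) * q.1)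
        (Set.Icc 0 t ×ˢ M) :=
      ((hf.smooth.continuousOn.mono (Set.prod_mono hsub subset_rfl)).norm.pow 2).add
        (continuousOn_const.mul continuousOn_fst)
    obtain ⟨⟨s, p⟩, ⟨hs0, hp⟩, hmax⟩ := (isCompact_Icc.prod hc).exists_isMaxOn
      ⟨(t, x), ⟨ht.1, le_rfl⟩, hx⟩ hcont
    change s ∈ Set.Icc 0 t at hs0
    change p ∈ M at hp
    have hmax' : ∀ s' ∈ Set.Icc 0 t, ∀ y ∈ M,
        ‖f s' y‖ ^ 2 + (2 * n - ε) * s' ≤ ‖f s p‖ ^ 2 + (2 * n - ε) * s :=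
      fun s' hs' y hy => isMaxOn_iff.1 hmax (s', y) ⟨hs', hy⟩
    have hsT := hsub hs0
    refine (hmax' t ⟨ht.1, le_rfl⟩ x hx).trans ?_
    rcases hs0.1.eq_or_lt with h0 | hspos
    · have hp0 : ‖p‖ = r₀ := by simpa using hs hp
      rw [← h0, hf.initial p hp, hp0, mul_zero, add_zero]
    · -- a maximum at a positive time has nonnegative left derivative in time
      exfalso
      have hH : ⟪f s p, meanCurvatureVector M (f s) p⟫ ≤ -(n : ℝ) := by
        refine (hf.immersion s hsT).inner_meanCurvatureVector_le hM hp fun y hy => ?_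
        have h1 := hmax' s hs0 y hy
        exact (sq_le_sq₀ (norm_nonneg _) (norm_nonneg _)).1 (by linarith)
      have hd := ((hf.flow s hsT p hp).norm_sq).add
        ((hasDerivWithinAt_id s (Set.Ico 0 T)).const_mul (2 * (n : ℝ) - ε))
      have hd' := hd.mono (s := Set.Ioo 0 s) fun s' hs' => ⟨hs'.1.le, hs'.2.trans hsT.2⟩
      rw [hasDerivWithinAt_iff_tendsto_slope' (by simp)] at hd'
      have hne : (𝓝[Set.Ioo 0 s] s).NeBot := by
        rw [nhdsWithin_Ioo_eq_nhdsLT hspos]; infer_instance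
      have h0 := ge_of_tendsto hd' (b := 0) (by
        filter_upwards [self_mem_nhdsWithin] with s' hs'
        rw [slope_def_field]
        have h1 := hmax' s' ⟨hs'.1.le, hs'.2.le.trans hs0.2⟩ p hp
        exact div_nonneg_of_nonpos (by simp only [Pi.add_apply, id]; linarith)
          (by linarith [hs'.2]))
      linarith
  have h2 : ∀ ε > 0, ‖f t x‖ ^ 2 + 2 * n * t ≤ r₀ ^ 2 + ε := by
    intro ε hε
    have ht1 : 0 < t + 1 := by linarith [ht.1]
    have h1 := key (ε / (t + 1)) (by positivity)
    have h3 : ε / (t + 1) * t ≤ ε := by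
      rw [div_mul_eq_mul_div, div_le_iff₀ ht1]
      nlinarith
    linarith
  have h3 := le_of_forall_pos_le_add h2
  linarith

theorem IsMeanCurvatureFlow.le_time {n : ℕ} (hn : 1 ≤ n) {M : Set 𝔼} (hM : IsSubmanifold n M)
    (hc : IsCompact M) (hne : M.Nonempty) {r₀ : ℝ} (hs : M ⊆ Metric.sphere 0 r₀) {T : ℝ}
    {f : ℝ → 𝔼 → 𝔼} (hf : IsMeanCurvatureFlow M T f) : T ≤ r₀ ^ 2 / (2 * n) := by
  have hn' : (0 : ℝ) < n := by exact_mod_cast hn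
  obtain ⟨x, hx⟩ := hne
  refine le_of_forall_lt fun t ht => ?_
  by_contra hcon
  push Not at hcon
  have ht0 : 0 ≤ t := (by positivity : 0 ≤ r₀ ^ 2 / (2 * (n : ℝ))).trans hcon
  obtain ⟨s, hts, hsT⟩ := exists_between ht
  have h1 := hf.norm_sq_le hM hc hs ⟨ht0.trans hts.le, hsT⟩ hx
  have h2 : r₀ ^ 2 / (2 * n) < s := hcon.trans_lt hts
  rw [div_lt_iff₀ (by positivity)] at h2
  have h3 := sq_nonneg ‖f s x‖
  linarith

/-! ### The flow of an isoparametric submanifold -/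

/-- If the flow equation is solvable on `[0, T)` at one point of a connected isoparametric
submanifold, it is solvable there at every point, because parallel transport conjugates the flow
equations of nearby points. -/
theorem IsFlowSolution.exists_forall {n : ℕ} {M : Set 𝔼} (hM : IsIsoparametric n M)
    (hconn : IsConnected M) {x₀ : 𝔼} (hx₀ : x₀ ∈ M) {T : ℝ} {ξ : ℝ → 𝔼}
    (h : IsFlowSolution M x₀ T ξ) : ∃ Ξ : 𝔼 → ℝ → 𝔼, ∀ y ∈ M, IsFlowSolution M y T (Ξ y) := by
  have key : ∀ y ∈ M, ∃ ζ, IsFlowSolution M y T ζ := by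
    intro y hy
    refine (hconn.isPreconnected.induction₂
      (fun a c => (∃ ζ, IsFlowSolution M a T ζ) ↔ ∃ ζ, IsFlowSolution M c T ζ) ?_
      (fun a c d _ _ _ h1 h2 => h1.trans h2) (fun a c _ _ h1 => h1.symm) hx₀ hy).1 ⟨ξ, h⟩
    intro a ha
    obtain ⟨U, τ, hτ⟩ := hM.exists_isParallelTransport ha
    filter_upwards [self_mem_nhdsWithin,
      mem_nhdsWithin_of_mem_nhds (hτ.isOpen.mem_nhds hτ.mem.2)] with c hc hcU
    exact ⟨fun ⟨ζ, hζ⟩ => ⟨_, hζ.transport hτ hM ⟨hc, hcU⟩⟩,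
      fun ⟨ζ, hζ⟩ => hζ.transport_symm hτ hM ⟨hc, hcU⟩⟩
  choose! Ξ hΞ using key
  exact ⟨Ξ, hΞ⟩

section GlobalField

variable {n : ℕ} {M : Set (EuclideanSpace ℝ (Fin N))} {T : ℝ}
  {Ξ : EuclideanSpace ℝ (Fin N) → ℝ → EuclideanSpace ℝ (Fin N)}

/-- By uniqueness, the solutions at nearby points are parallel transports of each other. -/
theorem IsParallelTransport.flowSolution_eq (hM : IsIsoparametric n M)
    (hΞ : ∀ y ∈ M, IsFlowSolution M y T (Ξ y)) {U : Set 𝔼} {p : 𝔼} {τ : 𝔼 → 𝔼 →L[ℝ] 𝔼}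
    (hτ : IsParallelTransport M U p τ) {y : 𝔼} (hy : y ∈ M ∩ U) {t : ℝ} (ht : t ∈ Set.Ico 0 T) :
    Ξ y t = τ y (Ξ p t) :=
  (hΞ y hy.1).eq ((hΞ p hτ.mem.1).transport hτ hM hy) ht ht

/-- The solutions of the flow equations at all points form a parallel normal field on all of `M`.
No global flatness of the normal bundle is needed. -/
theorem isParallelNormalField_flowSolution (hM : IsIsoparametric n M)
    (hΞ : ∀ y ∈ M, IsFlowSolution M y T (Ξ y)) {t : ℝ} (ht : t ∈ Set.Ico 0 T) :
    IsParallelNormalField M M fun y => Ξ y t := by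
  have hloc : ∀ x ∈ M, ∃ (U : Set 𝔼) (ζ : 𝔼 → 𝔼), IsOpen U ∧ x ∈ U ∧
      IsParallelNormalField M (M ∩ U) ζ ∧ (fun y => Ξ y t) =ᶠ[𝓝[M] x] ζ := by
    intro x hx
    obtain ⟨U, τ, hτ⟩ := hM.exists_isParallelTransport hx
    refine ⟨U, fun y => τ y (Ξ x t), hτ.isOpen, hτ.mem.2,
      hτ.parallel _ ((hΞ x hx).normal t ht), ?_⟩
    filter_upwards [self_mem_nhdsWithin,
      mem_nhdsWithin_of_mem_nhds (hτ.isOpen.mem_nhds hτ.mem.2)] with y hy hyU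
    exact hτ.flowSolution_eq hM hΞ ⟨hy, hyU⟩ ht
  refine ⟨fun x hx => ?_, fun x hx => (hΞ x hx).normal t ht, fun x hx v hv => ?_⟩
  · obtain ⟨U, ζ, hU, hxU, hζ, heq⟩ := hloc x hx
    have h1 : ContDiffWithinAt ℝ ∞ ζ M x :=
      (contDiffWithinAt_inter (hU.mem_nhds hxU)).1 (hζ.smooth x ⟨hx, hxU⟩)
    exact h1.congr_of_eventuallyEq heq (heq.self_of_nhdsWithin hx)
  · obtain ⟨U, ζ, hU, hxU, hζ, heq⟩ := hloc x hx
    rw [diff, heq.fderivWithin_eq (heq.self_of_nhdsWithin hx)]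
    exact hζ.parallel x ⟨hx, hxU⟩ v hv

theorem contDiffOn_flowSolution (hM : IsIsoparametric n M)
    (hΞ : ∀ y ∈ M, IsFlowSolution M y T (Ξ y)) :
    ContDiffOn ℝ ∞ (fun q : ℝ × 𝔼 => Ξ q.2 q.1) (Set.Ico 0 T ×ˢ M) := by
  rintro ⟨t, p⟩ ⟨ht, hp⟩
  obtain ⟨U, τ, hτ⟩ := hM.exists_isParallelTransport hp
  have h1 : ContDiffOn ℝ ∞ (fun q : ℝ × 𝔼 => τ q.2 (Ξ p q.1)) (Set.Ico 0 T ×ˢ (M ∩ U)) :=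
    (hτ.smooth.comp contDiffOn_snd fun q hq => hq.2).clm_apply
      ((hΞ p hp).contDiffOn.comp contDiffOn_fst fun q hq => hq.1)
  have h2 := (h1 (t, p) ⟨ht, hτ.mem⟩).congr (f₁ := fun q : ℝ × 𝔼 => Ξ q.2 q.1)
    (fun q hq => hτ.flowSolution_eq hM hΞ hq.2 hq.1) (hτ.flowSolution_eq hM hΞ hτ.mem ht)
  refine h2.mono_of_mem_nhdsWithin ?_
  filter_upwards [self_mem_nhdsWithin, mem_nhdsWithin_of_mem_nhds
    ((hτ.isOpen.preimage continuous_snd).mem_nhds hτ.mem.2)] with q hq hqU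
  exact ⟨hq.1, hq.2, hqU⟩

theorem isMeanCurvatureFlow_flowSolution (hM : IsIsoparametric n M)
    (hΞ : ∀ y ∈ M, IsFlowSolution M y T (Ξ y)) :
    IsMeanCurvatureFlow M T fun t y => y + Ξ y t where
  smooth := contDiffOn_snd.add (contDiffOn_flowSolution hM hΞ)
  initial := fun y hy => by rw [(hΞ y hy).initial, add_zero]
  immersion := fun t ht => by
    have hη := isParallelNormalField_flowSolution hM hΞ ht
    refine isImmersionOn_add hM.submanifold (η := fun y => Ξ y t) (by simpa using hη)
      fun y hy => ?_
    rw [eigenspace_one_eq_bot_iff hM hy (hη.normal y hy)]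
    exact fun w hw => ((hΞ y hy).chamber t ht w hw).ne
  flow := fun t ht y hy => by
    rw [meanCurvatureVector_add hM (isParallelNormalField_flowSolution hM hΞ ht) hy
      fun w hw => ((hΞ y hy).chamber t ht w hw).ne]
    exact ((hΞ y hy).hasDerivWithinAt ht).const_add y

end GlobalField

/-- The spatial differential of a smooth map on `[0, T) × M` depends continuously on time. -/
theorem continuousOn_diff_apply {n : ℕ} {M : Set 𝔼} (hM : IsSubmanifold n M) {T : ℝ}
    {f : ℝ → 𝔼 → 𝔼}
    (hf : ContDiffOn ℝ ∞ (fun q : ℝ × 𝔼 => f q.1 q.2) (Set.Ico 0 T ×ˢ M)) {x u : 𝔼} (hx : x ∈ M)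
    (hu : u ∈ tangentSpace M x) : ContinuousOn (fun t => diff M (f t) x u) (Set.Ico 0 T) := by
  obtain ⟨O, π, R, hxO, -⟩ := hM.exists_isRetraction hx
  set g : ℝ × 𝔼 → 𝔼 := fun q => f q.1 (π q.2) with hg
  set D : Set (ℝ × 𝔼) := Set.Ico 0 T ×ˢ O with hD
  have hgD : ContDiffOn ℝ ∞ g D :=
    hf.comp (contDiffOn_fst.prodMk (R.smooth.comp contDiffOn_snd fun q hq => hq.2))
      fun q hq => ⟨hq.1, (R.mapsTo _ hq.2).1⟩
  have hDu : UniqueDiffOn ℝ D := (uniqueDiffOn_Ico 0 T).prod R.isOpen.uniqueDiffOn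
  have h1 : ContinuousOn (fun t => fderivWithin ℝ g D (t, x) (0, u)) (Set.Ico 0 T) := by
    have h2 := hgD.continuousOn_fderivWithin hDu (by simp)
    have h3 : ContinuousOn (fun t => fderivWithin ℝ g D (t, x)) (Set.Ico 0 T) :=
      h2.comp (by fun_prop) fun t ht => ⟨ht, hxO.2⟩
    exact h3.clm_apply continuousOn_const
  refine h1.congr fun t ht => ?_
  have hft : ContDiffOn ℝ ∞ (f t) (M ∩ O) :=
    hf.comp (contDiffOn_const.prodMk contDiffOn_id) fun y hy => ⟨ht, hy.1⟩
  have h2 : HasFDerivWithinAt g (fderivWithin ℝ g D (t, x)) D (t, x) :=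
    ((hgD (t, x) ⟨ht, hxO.2⟩).differentiableWithinAt (by simp)).hasFDerivWithinAt
  have h3 : HasFDerivWithinAt (fun y : 𝔼 => (t, y)) (ContinuousLinearMap.inr ℝ ℝ 𝔼) O x :=
    (hasFDerivAt_prodMk_right t x).hasFDerivWithinAt
  have h4 := (h2.comp x h3 fun y hy => ⟨ht, hy⟩).hasFDerivAt (R.mem_nhds hxO)
  have h5 := h4.unique (R.hasFDerivAt_comp hft hxO.2)
  simp only
  rw [R.diff_eq hft hxO hu, ← h5]
  simp

/-- The flow of a maximal solution cannot be continued: at the final time either the solution is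
still in the chamber and can be extended, or the differential of the flow has a kernel. -/
theorem IsMeanCurvatureFlow.le_of_maximal {n : ℕ} {M : Set 𝔼} (hM : IsIsoparametric n M) {x₀ : 𝔼}
    (hx₀ : x₀ ∈ M) {T : ℝ} (hT : 0 < T) {ξ : ℝ → 𝔼} (hξ : IsFlowSolution M x₀ T ξ)
    (hmax : ∀ T' ξ', IsFlowSolution M x₀ T' ξ' → T' ≤ T) {f : ℝ → 𝔼 → 𝔼}
    (hpar : ∀ t ∈ Set.Ico 0 T, IsParallelNormalField M M (fun y => f t y - y) ∧
      f t x₀ = x₀ + ξ t)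
    {T' : ℝ} {f' : ℝ → 𝔼 → 𝔼} (hf' : IsMeanCurvatureFlow M T' f')
    (heq : ∀ t ∈ Set.Ico 0 T, ∀ y ∈ M, f' t y = f t y) : T' ≤ T := by
  by_contra hlt
  push Not at hlt
  have hTmem : T ∈ Set.Ico 0 T' := ⟨hT.le, hlt⟩
  have hle : 𝓝[<] T ≤ 𝓝[Set.Ico 0 T'] T := by
    rw [← nhdsWithin_Ico_eq_nhdsLT hT]
    exact nhdsWithin_mono _ (Set.Ico_subset_Ico_right hlt.le)
  have hIco : Set.Ico 0 T ∈ 𝓝[<] T := Ico_mem_nhdsLT hT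
  have hlim : Tendsto ξ (𝓝[<] T) (𝓝 (f' T x₀ - x₀)) := by
    have h1 := ((hf'.flow T hTmem x₀ hx₀).continuousWithinAt.tendsto.mono_left hle).sub_const x₀
    refine h1.congr' ?_
    filter_upwards [hIco] with t ht
    rw [heq t ht x₀ hx₀, (hpar t ht).2, add_sub_cancel_left]
  by_cases hz : f' T x₀ - x₀ ∈ chamber M x₀
  · obtain ⟨T₁, ξ₁, hT₁, h₁⟩ := hξ.exists_extension hT hlim hz
    exact absurd (hmax T₁ ξ₁ h₁) (not_le.2 hT₁)
  · simp only [chamber, Set.mem_ofPred_eq, not_forall, not_lt] at hz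
    obtain ⟨w, hw, hzw⟩ := hz
    have hinner : Tendsto (fun t => 1 - ⟪ξ t, w⟫) (𝓝[<] T) (𝓝 0) := by
      have h1 : Tendsto (fun t => ⟪ξ t, w⟫) (𝓝[<] T) (𝓝 ⟪f' T x₀ - x₀, w⟫) :=
        hlim.inner tendsto_const_nhds
      have h2 : ⟪f' T x₀ - x₀, w⟫ ≤ 1 := le_of_tendsto h1 (by
        filter_upwards [hIco] with t ht using (hξ.chamber t ht w hw).le)
      have h3 := h1.const_sub 1
      rwa [le_antisymm h2 hzw, sub_self] at h3
    -- a principal direction `u` of `w` is scaled by `1 - ⟪ξ t, w⟫ → 0`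
    obtain ⟨u, hu, hu0⟩ := Submodule.exists_mem_ne_zero_of_ne_bot (mem_curvatureNormals.1 hw).2
    have hdiff : ∀ t ∈ Set.Ico 0 T, diff M (f' t) x₀ u = (1 - ⟪ξ t, w⟫) • (u : 𝔼) := by
      intro t ht
      have hη := (hpar t ht).1
      have h1 : diff M (f' t) x₀ = diff M (fun y => y + (f t y - y)) x₀ := by
        refine fderivWithin_congr (fun y hy => ?_) ?_
        · rw [heq t ht y hy, add_sub_cancel]
        · rw [heq t ht x₀ hx₀, add_sub_cancel]
      rw [h1, diff_add_apply hM.submanifold (η := fun y => f t y - y) (by simpa using hη) hx₀,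
        mem_curvatureSpace.1 hu _ (hη.normal x₀ hx₀), (hpar t ht).2, add_sub_cancel_left, sub_smul,
        one_smul]
      rfl
    have hlim1 : Tendsto (fun t => diff M (f' t) x₀ u) (𝓝[<] T) (𝓝 0) := by
      have h1 := hinner.smul_const (u : 𝔼)
      rw [zero_smul] at h1
      refine h1.congr' ?_
      filter_upwards [hIco] with t ht using (hdiff t ht).symm
    have hlim2 : Tendsto (fun t => diff M (f' t) x₀ u) (𝓝[<] T) (𝓝 (diff M (f' T) x₀ u)) :=
      (continuousOn_diff_apply hM.submanifold hf'.smooth hx₀ u.2 T hTmem).tendsto.mono_left hle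
    have h0 := (hf'.immersion T hTmem).2 x₀ hx₀ u u.2 (tendsto_nhds_unique hlim2 hlim1)
    exact hu0 (Subtype.ext h0)

/-- A parallel normal field on a connected isoparametric submanifold which lies in the chamber at
one point defines an immersion, by the constancy of the principal curvatures. -/
theorem isImmersionOn_add_of_mem_chamber {n : ℕ} {M : Set 𝔼} (hM : IsIsoparametric n M)
    (hconn : IsConnected M) {x₀ : 𝔼} (hx₀ : x₀ ∈ M) {η : 𝔼 → 𝔼} (hη : IsParallelNormalField M M η)
    (hch : η x₀ ∈ chamber M x₀) : IsImmersionOn M fun y => y + η y := by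
  have hη' : IsParallelNormalField M (M ∩ Set.univ) η := by simpa using hη
  refine isImmersionOn_add hM.submanifold hη' fun y hy => ?_
  have h1 := hM.constant Set.univ η isOpen_univ (by simpa using hconn.isPreconnected) hη'
    x₀ ⟨hx₀, trivial⟩ y ⟨hy, trivial⟩ 1
  rw [(eigenspace_one_eq_bot_iff hM hx₀ (hη.normal x₀ hx₀)).2 fun w hw => (hch w hw).ne,
    finrank_bot] at h1
  exact Submodule.finrank_eq_zero.1 h1.symm

end MCFIso

theorem theorem3p2 {N n : ℕ} (hn : 1 ≤ n) (r₀ : ℝ) (hr₀ : 0 < r₀)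
    (M : Set (EuclideanSpace ℝ (Fin N)))
    (hM : MCFIso.IsIsoparametric n M) (hcomp : IsCompact M) (hconn : IsConnected M)
    (hsphere : M ⊆ Metric.sphere 0 r₀)
    (x₀ : EuclideanSpace ℝ (Fin N)) (hx₀ : x₀ ∈ M) :
    -- every solution `ξ` of the flow equation, with `x(t) = x₀ + ξ(t)`
    (∀ (T : ℝ) (ξ : ℝ → EuclideanSpace ℝ (Fin N)), MCFIso.IsFlowSolution M x₀ T ξ →
      ∀ t ∈ Set.Ico 0 T,
        (∀ ν ∈ MCFIso.curvatureNormals M x₀, ⟪x₀ + ξ t, ν⟫ ≠ 0) ∧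
        HasDerivWithinAt (fun s => x₀ + ξ s)
          (-∑ ν ∈ MCFIso.curvatureNormals M x₀,
            ((MCFIso.multiplicity M x₀ ν : ℝ) / ⟪x₀ + ξ t, ν⟫) • ν) (Set.Ico 0 T) t ∧
        -- the parallel submanifold `M(t)`, defined by the parallel normal field through `ξ(t)`
        (∃ η, MCFIso.IsParallelNormalField M M η ∧ η x₀ = ξ t) ∧
        (∀ η, MCFIso.IsParallelNormalField M M η → η x₀ = ξ t →
          MCFIso.IsImmersionOn M (fun y => y + η y) ∧
          ⟪x₀ + ξ t, MCFIso.meanCurvatureVector M (fun y => y + η y) x₀⟫ = -(n : ℝ)) ∧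
        ‖x₀ + ξ t‖ ^ 2 = ‖x₀ + ξ 0‖ ^ 2 - 2 * n * t) ∧
    -- the maximal solution exists on `[0, T)` with `0 < T ≤ r₀² / (2n)`, and the mean curvature
    -- flow that it gives cannot be continued beyond `T`
    (∃ (T : ℝ) (ξ : ℝ → EuclideanSpace ℝ (Fin N))
        (f : ℝ → EuclideanSpace ℝ (Fin N) → EuclideanSpace ℝ (Fin N)),
      0 < T ∧ T ≤ r₀ ^ 2 / (2 * n) ∧
      MCFIso.IsFlowSolution M x₀ T ξ ∧
      (∀ (T' : ℝ) (ξ' : ℝ → EuclideanSpace ℝ (Fin N)), MCFIso.IsFlowSolution M x₀ T' ξ' →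
        T' ≤ T ∧ Set.EqOn ξ' ξ (Set.Ico 0 T')) ∧
      MCFIso.IsMeanCurvatureFlow M T f ∧
      (∀ t ∈ Set.Ico 0 T, MCFIso.IsParallelNormalField M M (fun y => f t y - y) ∧
        f t x₀ = x₀ + ξ t) ∧
      (∀ (T' : ℝ) (f' : ℝ → EuclideanSpace ℝ (Fin N) → EuclideanSpace ℝ (Fin N)),
        MCFIso.IsMeanCurvatureFlow M T' f' →
        (∀ t ∈ Set.Ico 0 T, ∀ y ∈ M, f' t y = f t y) → T' ≤ T)) ∧
    -- no mean curvature flow with initial data `M` exists for longer than `r₀² / (2n)`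
    (∀ (T : ℝ) (f : ℝ → EuclideanSpace ℝ (Fin N) → EuclideanSpace ℝ (Fin N)),
      MCFIso.IsMeanCurvatureFlow M T f → T ≤ r₀ ^ 2 / (2 * n)) := by
  open MCFIso in
  refine ⟨fun T ξ hξ t ht => ?_, ?_, fun T f hf =>
    hf.le_time hn hM.submanifold hcomp ⟨x₀, hx₀⟩ hsphere⟩
  · have hin : ∀ ν ∈ curvatureNormals M x₀, ⟪x₀ + ξ t, ν⟫ = -(1 - ⟪ξ t, ν⟫) := fun ν hν => by
      rw [inner_add_left, inner_curvatureNormal hM.submanifold hsphere hx₀ hν]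
      ring
    refine ⟨fun ν hν => ?_, ?_, ?_, fun η hη hηx => ⟨?_, ?_⟩, hξ.norm_sq hM hsphere hx₀ ht⟩
    · rw [hin ν hν]
      have := hξ.chamber t ht ν hν
      exact (by linarith : -(1 - ⟪ξ t, ν⟫) < 0).ne
    · refine ((hξ.flow t ht).const_add x₀).congr_deriv ?_
      rw [← Finset.sum_neg_distrib]
      refine Finset.sum_congr rfl fun ν hν => ?_
      rw [hin ν hν, div_neg, neg_smul, neg_neg]
    · obtain ⟨Ξ, hΞ⟩ := hξ.exists_forall hM hconn hx₀
      exact ⟨fun y => Ξ y t, isParallelNormalField_flowSolution hM hΞ ht, (hΞ x₀ hx₀).eq hξ ht ht⟩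
    · exact isImmersionOn_add_of_mem_chamber hM hconn hx₀ hη (hηx ▸ hξ.chamber t ht)
    · rw [meanCurvatureVector_add hM hη hx₀ fun w hw => hηx ▸ (hξ.chamber t ht w hw).ne, hηx]
      exact inner_flowField hM hsphere hx₀ (hξ.chamber t ht)
  · obtain ⟨T, ξ, hT, hξ, hmax⟩ := exists_maximal_isFlowSolution (M := M) (x := x₀)
      (B := r₀ ^ 2 / (2 * n)) fun T ξ hξ => hξ.le_time hn hM hsphere hx₀
    obtain ⟨Ξ, hΞ⟩ := hξ.exists_forall hM hconn hx₀
    have hpar : ∀ t ∈ Set.Ico 0 T, IsParallelNormalField M M (fun y => y + Ξ y t - y) ∧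
        x₀ + Ξ x₀ t = x₀ + ξ t := fun t ht => by
      simp only [add_sub_cancel_left]
      exact ⟨isParallelNormalField_flowSolution hM hΞ ht, by rw [(hΞ x₀ hx₀).eq hξ ht ht]⟩
    exact ⟨T, ξ, fun t y => y + Ξ y t, hT, hξ.le_time hn hM hsphere hx₀, hξ, hmax,
      isMeanCurvatureFlow_flowSolution hM hΞ, hpar, fun T' f' hf' heq =>
        hf'.le_of_maximal hM hx₀ hT hξ (fun T' ξ' h => (hmax T' ξ' h).1) hpar heq⟩
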